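/- There is an absolute constant $C>0$ such that the following holds. Let $f=\frac1N\sum_{i=1}^N f_i:\mathbb R^m\times\mathbb R^n\to\mathbb R$ ($N\ge 1$, each $f_i$ twice continuously differentiable) be convex in $x$ and concave in $y$, with $\|\nabla^2 f(z)-\nabla^2 f(z')\|\le\rho\|z-z'\|$ for all $z,z'$, where $\rho>0$, and let $z^\star=(x^\star,y^\star)$ be a global saddle point of $f$. Write $z=(x,y)$, $F(z)=(\nabla_x f(z),-\nabla_y f(z))$, and for $\beta\ge 0$ $$\mathrm{Gap}(\hat x,\hat y;\beta)=\max_{\|y-y^\star\|\le\beta}f(\hat x,y)-\min_{\|x-x^\star\|\le\beta}f(x,\hat y).$$ Fix one of the following two settings, with constants $B_1,\dots,B_N$ and $B_{\max}=\max_i B_i$. (U) $\|\nabla^2 f_i(z)\|\le B_i$ for all $i,z$. Samples of size $s$ are drawn uniformly from $\{1,\dots,N\}$, with or without replacement; $p_i=\frac1N$ and $\Theta(\tau,\delta')=\frac{16B_{\max}^2}{\tau^2}\log\frac{2(m+n)}{\delta'}$. (N) $f_i(x,y)=\varphi_i(a_i^\top x,b_i^\top y)$ with $\varphi_i\in C^2(\mathbb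 R^2)$ and $w_i(z):=\|\varphi_i''(a_i^\top x,b_i^\top y)\|(\|a_i\|^2+\|b_i\|^2)\le B_i$ for all $i,z$. Samples consist of $s$ independent draws from $p_i=p_i(z)=w_i(z)/\sum_j w_j(z)$ (with $p_i=\frac1N$ if all $w_j(z)$ vanish), and $\Theta(\tau,\delta')=\frac{4B_{\mathrm{avg}}^2}{\tau^2}\log\frac{2(m+n)}{\delta'}$, where $B_{\mathrm{avg}}=\frac1N\sum_i B_i$. Let $0<\kappa_m<\min\{1,\frac\rho4\}$, $0<\tau_0<\frac\rho4$, $\delta\in(0,1)$, $T\ge1$, $z_0\in\mathbb R^m\times\mathbb R^n$, and put $\delta_T=1-(1-\delta)^{1/T}$. Consider any run of the following method. Set $\hat z_0=z_0$. For $k=0,\dots,T-1$: 1. If $z_k$ or $\hat z_k$ is a global saddle point of $f$, stop and return it. 2. Choose $\tau_k$ with $0<\tau_k\le\min\{\tau_0,\frac{\rho(1-\kappa_m)}{4(B_{\max}+6\rho)}\|\nabla f(\hat z_k)\|\}$ and a sample size $s_k\ge1$ with $s_k\ge\Theta(\tau_k,\delta_T)$. Given the past, draw a sample $\mathcal S_k$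 of size $s_k$ as above (at $z=\hat z_k$), and form $H_k=\frac1{N|\mathcal S_k|}\sum_{i\in\mathcal S_k}\frac1{p_i}\nabla^2 f_i(\hat z_k)$. 3. Find $\Delta z_k=(\Delta x_k,\Delta y_k)$ with $\|\nabla m_k(\Delta z_k)\|\le\kappa_m\min\{\|\Delta z_k\|^2,\|\nabla f(\hat z_k)\|\}$, where $m_k(\Delta z)=\Delta z^\top\nabla f(\hat z_k)+\frac12\Delta z^\top H_k\Delta z+2\rho\|\Delta x\|^3-2\rho\|\Delta y\|^3$. 4. Choose $\lambda_{k+1}>0$ with $\frac1{15}\le\lambda_{k+1}\rho\|\Delta z_k\|\le\frac1{14}$; set $z_{k+1}=\hat z_k+\Delta z_k$ and $\hat z_{k+1}=\hat z_k-\lambda_{k+1}F(z_{k+1})$. If the method has not stopped, it returns $\big(\sum_{k=1}^T\lambda_k\big)^{-1}\sum_{k=1}^T\lambda_k z_k$. All choices may depend on the past (including past samples) in any measurable way. Then for each $k<T$ the probability that iteration $k$ is performed and $\|H_k-\nabla^2 f(\hat z_k)\|>\tau_k$ is at most $\delta_T=1-(1-\delta)^{1/T}$. Moreover, with $\beta=8\|z_0-z^\star\|$,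 there is an event of probability at least $1-\delta$ on which all iterates are bounded, namely $\|z_k-z^\star\|\le\beta$ and $\|\hat z_k-z^\star\|\le\beta$ for all generated $k\le T$, and on which, for every $\varepsilon>0$ with $$T\ \ge\ C\Big(\frac{\rho\,\|z_0-z^\star\|^3}{\varepsilon}\Big)^{2/3},$$ the returned point $(\hat x,\hat y)$ is an $\varepsilon$-global saddle point: $\max\{\|\hat x-x^\star\|,\|\hat y-y^\star\|\}\le\beta$ and $\mathrm{Gap}(\hat x,\hat y;\beta)\le\varepsilon$. That is, the method reaches an $\varepsilon$-global saddle point within $O(\varepsilon^{-2/3})$ iterations with probability at least $1-\delta$. -/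

import Mathlib

open MeasureTheory ProbabilityTheory
open scoped RealInnerProductSpace

noncomputable section

/-- The space `ℝ^m × ℝ^n` of pairs `z = (x, y)`, with the Euclidean norm
`‖z‖ = √(‖x‖² + ‖y‖²)`. -/
abbrev PairSpace (m n : ℕ) : Type :=
  WithLp 2 (EuclideanSpace ℝ (Fin m) × EuclideanSpace ℝ (Fin n))

/-- The pair `(x, y)` as a point of `PairSpace m n`. -/
abbrev mkPair {m n : ℕ} (x : EuclideanSpace ℝ (Fin m)) (y : EuclideanSpace ℝ (Fin n)) :
    PairSpace m n :=
  WithLp.toLp 2 (x, y)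

/-- The Hessian `∇²g(z)`, as a continuous linear operator; its norm is the spectral norm. -/
def hess {E : Type*} [NormedAddCommGroup E] [InnerProductSpace ℝ E] [CompleteSpace E]
    (g : E → ℝ) (z : E) : E →L[ℝ] E :=
  fderiv ℝ (gradient g) z

/-- `f(x, y)` is convex in `x` for every `y` and concave in `y` for every `x`. -/
def IsConvexConcave {m n : ℕ} (f : PairSpace m n → ℝ) : Prop :=
  (∀ y, ConvexOn ℝ Set.univ (fun x => f (mkPair x y))) ∧
  (∀ x, ConcaveOn ℝ Set.univ (fun y => f (mkPair x y)))

/-- `f` is `ρ`-Hessian Lipschitz. -/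
def IsHessianLipschitz {m n : ℕ} (ρ : ℝ) (f : PairSpace m n → ℝ) : Prop :=
  ∀ z z', ‖hess f z - hess f z'‖ ≤ ρ * ‖z - z'‖

/-- `w = (x⋆, y⋆)` is a global saddle point of `f`. -/
def IsGlobalSaddle {m n : ℕ} (f : PairSpace m n → ℝ) (w : PairSpace m n) : Prop :=
  ∀ x y, f (mkPair w.fst y) ≤ f w ∧ f w ≤ f (mkPair x w.snd)

/-- The restricted gap
`Gap(w; β) = max_{‖y - y⋆‖ ≤ β} f(w_x, y) - min_{‖x - x⋆‖ ≤ β} f(x, w_y)`. -/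
def restrictedGap {m n : ℕ} (f : PairSpace m n → ℝ) (zstar : PairSpace m n) (β : ℝ)
    (w : PairSpace m n) : ℝ :=
  sSup ((fun y => f (mkPair w.fst y)) '' Metric.closedBall zstar.snd β) -
    sInf ((fun x => f (mkPair x w.snd)) '' Metric.closedBall zstar.fst β)

/-- `w` is an `ε`-global saddle point with respect to the saddle point `zstar` and a radius `β`
that is large enough for `w`. -/
def IsEpsGlobalSaddle {m n : ℕ} (f : PairSpace m n → ℝ) (zstar : PairSpace m n) (β ε : ℝ)
    (w : PairSpace m n) : Prop :=
  max ‖w.fst - zstar.fst‖ ‖w.snd - zstar.snd‖ ≤ β ∧ restrictedGap f zstar β w ≤ ε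

/-- `F(z) = (∇ₓ f(z), -∇_y f(z))`. -/
def saddleOperator {m n : ℕ} (f : PairSpace m n → ℝ) (z : PairSpace m n) : PairSpace m n :=
  mkPair (gradient f z).fst (-(gradient f z).snd)

/-- The finite-sum objective `f = (1/N) ∑ᵢ fᵢ`. -/
def finiteSum {m n N : ℕ} (f : Fin N → PairSpace m n → ℝ) (z : PairSpace m n) : ℝ :=
  (1 / (N : ℝ)) * ∑ i, f i z

/-- The law of `s` independent draws from the probability vector `p`: the probability of
obtaining the list `l` of indices, in order. -/
def lawWithReplacement {N : ℕ} (p : Fin N → ℝ) (s : ℕ) (l : List (Fin N)) : ℝ :=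
  if l.length = s then (l.map p).prod else 0

/-- The law of `s` uniform draws without replacement from the `N` indices: every ordered list of
`s` distinct indices has probability `1 / (N (N - 1) ⋯ (N - s + 1))`. -/
def lawWithoutReplacement (N s : ℕ) (l : List (Fin N)) : ℝ :=
  if l.length = s ∧ l.Nodup then ((N.descFactorial s : ℕ) : ℝ)⁻¹ else 0

/-- The subsampled Hessian `H(z) = (1 / (N |S|)) ∑_{i ∈ S} (1 / pᵢ) ∇²fᵢ(z)`; the sample `S` is a
list, as indices may repeat. -/
def subsampledHessian {m n N : ℕ} (f : Fin N → PairSpace m n → ℝ) (p : Fin N → ℝ)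
    (S : List (Fin N)) (z : PairSpace m n) : PairSpace m n →L[ℝ] PairSpace m n :=
  (1 / ((N : ℝ) * (S.length : ℝ))) • (S.map (fun i => (1 / p i) • hess (f i) z)).sum

/-- The ingredients of a way of subsampling the Hessian at a point `z`. -/
structure SamplingScheme (m n N : ℕ) where
  /-- the largest of the bounds `B_1, …, B_N` -/
  Bmax : ℝ
  /-- the sampling probabilities `p₁, …, p_N` at `z` -/
  prob : PairSpace m n → Fin N → ℝ
  /-- the law of a sample of size `s` at `z` -/
  law : PairSpace m n → ℕ → List (Fin N) → ℝ
  /-- the least sample size `Θ(τ, δ)` for accuracy `τ` and failure probability `δ` -/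
  minSize : ℝ → ℝ → ℝ

/-- Uniform sampling with replacement, with
`Θ(τ, δ) = (16 B_max² / τ²) log (2 (m + n) / δ)`. -/
def uniformWithReplacement (m n : ℕ) {N : ℕ} (B : Fin N → ℝ) : SamplingScheme m n N where
  Bmax := ⨆ i, B i
  prob := fun _ _ => 1 / (N : ℝ)
  law := fun _ s l => lawWithReplacement (fun _ => 1 / (N : ℝ)) s l
  minSize := fun τ δ => 16 * (⨆ i, B i) ^ 2 / τ ^ 2 * Real.log (2 * ((m : ℝ) + n) / δ)

/-- Uniform sampling without replacement, with the same `Θ`. -/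
def uniformWithoutReplacement (m n : ℕ) {N : ℕ} (B : Fin N → ℝ) : SamplingScheme m n N where
  Bmax := ⨆ i, B i
  prob := fun _ _ => 1 / (N : ℝ)
  law := fun _ s l => lawWithoutReplacement N s l
  minSize := fun τ δ => 16 * (⨆ i, B i) ^ 2 / τ ^ 2 * Real.log (2 * ((m : ℝ) + n) / δ)

/-- The point `(aᵀx, bᵀy)` of the Euclidean plane. -/
def planePoint {m n : ℕ} (a : EuclideanSpace ℝ (Fin m)) (b : EuclideanSpace ℝ (Fin n))
    (z : PairSpace m n) : WithLp 2 (ℝ × ℝ) :=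
  WithLp.toLp 2 (⟪a, z.fst⟫, ⟪b, z.snd⟫)

/-- The weight `‖φ''(aᵀx, bᵀy)‖ (‖a‖² + ‖b‖²)`. -/
def importanceWeight {m n : ℕ} (φ : WithLp 2 (ℝ × ℝ) → ℝ) (a : EuclideanSpace ℝ (Fin m))
    (b : EuclideanSpace ℝ (Fin n)) (z : PairSpace m n) : ℝ :=
  ‖hess φ (planePoint a b z)‖ * (‖a‖ ^ 2 + ‖b‖ ^ 2)

/-- The nonuniform sampling probabilities: proportional to the weights; uniform in the degenerate
case that all the weights vanish (and with them all the Hessians). -/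
def importanceProb {m n N : ℕ} (φ : Fin N → WithLp 2 (ℝ × ℝ) → ℝ)
    (a : Fin N → EuclideanSpace ℝ (Fin m)) (b : Fin N → EuclideanSpace ℝ (Fin n))
    (z : PairSpace m n) (i : Fin N) : ℝ :=
  if ∑ j, importanceWeight (φ j) (a j) (b j) z = 0 then 1 / (N : ℝ)
  else importanceWeight (φ i) (a i) (b i) z / ∑ j, importanceWeight (φ j) (a j) (b j) z

/-- Nonuniform sampling (independent draws), with
`Θ(τ, δ) = (4 B_avg² / τ²) log (2 (m + n) / δ)`, where `B_avg = (1/N) ∑ᵢ Bᵢ`. -/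
def nonuniformScheme {m n N : ℕ} (φ : Fin N → WithLp 2 (ℝ × ℝ) → ℝ)
    (a : Fin N → EuclideanSpace ℝ (Fin m)) (b : Fin N → EuclideanSpace ℝ (Fin n))
    (B : Fin N → ℝ) : SamplingScheme m n N where
  Bmax := ⨆ i, B i
  prob := importanceProb φ a b
  law := fun z s l => lawWithReplacement (importanceProb φ a b z) s l
  minSize := fun τ δ =>
    4 * ((1 / (N : ℝ)) * ∑ i, B i) ^ 2 / τ ^ 2 * Real.log (2 * ((m : ℝ) + n) / δ)

/-- The sampling schemes for the components `f₁, …, f_N`: uniform sampling, with or without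
replacement, if `‖∇²fᵢ‖ ≤ Bᵢ` everywhere; nonuniform sampling if `fᵢ(x, y) = φᵢ(aᵢᵀx, bᵢᵀy)` and
`‖φᵢ''(aᵢᵀx, bᵢᵀy)‖ (‖aᵢ‖² + ‖bᵢ‖²) ≤ Bᵢ` everywhere. -/
inductive IsSamplingSchemeFor {m n N : ℕ} (f : Fin N → PairSpace m n → ℝ) :
    SamplingScheme m n N → Prop
  | uniform_with (B : Fin N → ℝ) (hB : ∀ i z, ‖hess (f i) z‖ ≤ B i) :
      IsSamplingSchemeFor f (uniformWithReplacement m n B)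
  | uniform_without (B : Fin N → ℝ) (hB : ∀ i z, ‖hess (f i) z‖ ≤ B i) :
      IsSamplingSchemeFor f (uniformWithoutReplacement m n B)
  | nonuniform (φ : Fin N → WithLp 2 (ℝ × ℝ) → ℝ)
      (a : Fin N → EuclideanSpace ℝ (Fin m)) (b : Fin N → EuclideanSpace ℝ (Fin n))
      (B : Fin N → ℝ) (hφ : ∀ i, ContDiff ℝ 2 (φ i))
      (hf : ∀ i z, f i z = φ i (planePoint (a i) (b i) z))
      (hB : ∀ i z, importanceWeight (φ i) (a i) (b i) z ≤ B i) :
      IsSamplingSchemeFor f (nonuniformScheme φ a b B)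

/-- The cubic regularized model
`m(Δ) = Δᵀ∇f(ẑ) + ½ ΔᵀHΔ + 2ρ‖Δx‖³ - 2ρ‖Δy‖³`, where `g = ∇f(ẑ)`. -/
def cubicModel {m n : ℕ} (ρ : ℝ) (g : PairSpace m n) (H : PairSpace m n →L[ℝ] PairSpace m n)
    (d : PairSpace m n) : ℝ :=
  ⟪d, g⟫ + (1 / 2) * ⟪d, H d⟫ + 2 * ρ * ‖d.fst‖ ^ 3 - 2 * ρ * ‖d.snd‖ ^ 3

/-- The random quantities that appear in a run of the method: the iterates `z k` and `zhat k`, the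
updates `step k` (that is, `Δz_k`), the stepsizes `lam k`, the accuracies `tau k`, the sample sizes
`size k` and the samples `sample k`. -/
structure NewtonProcess (Ω : Type*) (m n N : ℕ) where
  z : ℕ → Ω → PairSpace m n
  zhat : ℕ → Ω → PairSpace m n
  step : ℕ → Ω → PairSpace m n
  lam : ℕ → Ω → ℝ
  tau : ℕ → Ω → ℝ
  size : ℕ → Ω → ℕ
  sample : ℕ → Ω → List (Fin N)

namespace NewtonProcess

variable {Ω : Type*} {m n N : ℕ}

/-- The stopping test at iteration `k`: one of the current points is a global saddle point. -/
def Stops (P : NewtonProcess Ω m n N) (f : PairSpace m n → ℝ) (k : ℕ) (ω : Ω) : Prop :=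
  IsGlobalSaddle f (P.z k ω) ∨ IsGlobalSaddle f (P.zhat k ω)

/-- The inexact Hessian `H(ẑ_k)`. -/
def inexactHess (P : NewtonProcess Ω m n N) (f : Fin N → PairSpace m n → ℝ)
    (S : SamplingScheme m n N) (k : ℕ) (ω : Ω) : PairSpace m n →L[ℝ] PairSpace m n :=
  subsampledHessian f (S.prob (P.zhat k ω)) (P.sample k ω) (P.zhat k ω)

/-- The weighted average `(∑_{k=1}^T λ_k z_k) / ∑_{k=1}^T λ_k`. -/
def average (P : NewtonProcess Ω m n N) (T : ℕ) (ω : Ω) : PairSpace m n :=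
  (∑ k ∈ Finset.Icc 1 T, P.lam k ω)⁻¹ • ∑ k ∈ Finset.Icc 1 T, P.lam k ω • P.z k ω

open Classical in
/-- What the method returns: the global saddle point at which it stopped, if it stopped in one of
the iterations `0, …, T - 1` (the iterates are constant from then on), else the average. -/
def output (P : NewtonProcess Ω m n N) (f : PairSpace m n → ℝ) (T : ℕ) (ω : Ω) :
    PairSpace m n :=
  if IsGlobalSaddle f (P.z (T - 1) ω) then P.z (T - 1) ω
  else if IsGlobalSaddle f (P.zhat (T - 1) ω) then P.zhat (T - 1) ω
  else P.average T ω

end NewtonProcess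

/-- `P` is a run of the subsampled Newton method for `f = (1/N) ∑ᵢ fᵢ` with `T` iterations, started
at `z0`. The σ-algebra `ℱ k` stands for what is known at the start of iteration `k`; every choice
that the method leaves open may depend on the past in any way. -/
structure IsSubsampledNewtonRun {Ω : Type*} {mΩ : MeasurableSpace Ω} {m n N : ℕ}
    (μ : Measure Ω) (ℱ : Filtration ℕ mΩ) (f : Fin N → PairSpace m n → ℝ)
    (S : SamplingScheme m n N) (ρ κm τ₀ δ : ℝ) (T : ℕ) (z0 : PairSpace m n)
    (P : NewtonProcess Ω m n N) : Prop where
  /- measurability: what is known when -/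
  measurable_z : ∀ k ≤ T, StronglyMeasurable[ℱ k] (P.z k)
  measurable_zhat : ∀ k ≤ T, StronglyMeasurable[ℱ k] (P.zhat k)
  measurable_tau : ∀ k < T, Measurable[ℱ k] (P.tau k)
  measurable_size : ∀ k < T, Measurable[ℱ k] (P.size k)
  measurable_sample : ∀ k < T, ∀ l, MeasurableSet[ℱ (k + 1)] {ω | P.sample k ω = l}
  measurable_step : ∀ k < T, StronglyMeasurable[ℱ (k + 1)] (P.step k)
  measurable_lam : ∀ k < T, Measurable[ℱ (k + 1)] (P.lam (k + 1))
  /- initialization -/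
  init : ∀ᵐ ω ∂μ, P.z 0 ω = z0 ∧ P.zhat 0 ω = z0
  /- once the stopping test succeeds, nothing changes any more -/
  frozen : ∀ k < T, ∀ᵐ ω ∂μ, P.Stops (finiteSum f) k ω →
    P.z (k + 1) ω = P.z k ω ∧ P.zhat (k + 1) ω = P.zhat k ω
  /- the accuracy `τ_k` -/
  tau_spec : ∀ k < T, ∀ᵐ ω ∂μ, ¬ P.Stops (finiteSum f) k ω →
    0 < P.tau k ω ∧
    P.tau k ω ≤ min τ₀
      (ρ * (1 - κm) / (4 * (S.Bmax + 6 * ρ)) * ‖gradient (finiteSum f) (P.zhat k ω)‖)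
  /- the sample size, for the failure probability `1 - (1 - δ)^{1/T}` -/
  size_spec : ∀ k < T, ∀ᵐ ω ∂μ, ¬ P.Stops (finiteSum f) k ω →
    1 ≤ P.size k ω ∧
    S.minSize (P.tau k ω) (1 - (1 - δ) ^ (1 / (T : ℝ))) ≤ P.size k ω
  /- given the past, the sample is drawn from the prescribed law -/
  sample_spec : ∀ k < T, ∀ l, ∀ᵐ ω ∂μ, ¬ P.Stops (finiteSum f) k ω →
    (μ⟦{ω' | P.sample k ω' = l} | ℱ k⟧) ω = S.law (P.zhat k ω) (P.size k ω) l
  /- inexact solution of the cubic regularized subproblem -/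
  step_spec : ∀ k < T, ∀ᵐ ω ∂μ, ¬ P.Stops (finiteSum f) k ω →
    ‖gradient (cubicModel ρ (gradient (finiteSum f) (P.zhat k ω)) (P.inexactHess f S k ω))
        (P.step k ω)‖ ≤
      κm * min (‖P.step k ω‖ ^ 2) ‖gradient (finiteSum f) (P.zhat k ω)‖
  /- the stepsize `λ_{k+1}` -/
  lam_spec : ∀ k < T, ∀ᵐ ω ∂μ, ¬ P.Stops (finiteSum f) k ω →
    0 < P.lam (k + 1) ω ∧ 1 / 15 ≤ P.lam (k + 1) ω * ρ * ‖P.step k ω‖ ∧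
    P.lam (k + 1) ω * ρ * ‖P.step k ω‖ ≤ 1 / 14
  /- the update of `z` and the extragradient update of `zhat` -/
  update_z : ∀ k < T, ∀ᵐ ω ∂μ, ¬ P.Stops (finiteSum f) k ω →
    P.z (k + 1) ω = P.zhat k ω + P.step k ω
  update_zhat : ∀ k < T, ∀ᵐ ω ∂μ, ¬ P.Stops (finiteSum f) k ω →
    P.zhat (k + 1) ω =
      P.zhat k ω - P.lam (k + 1) ω • saddleOperator (finiteSum f) (P.z (k + 1) ω)

end

/-! The proof joins a deterministic extragradient analysis to a concentration bound for sampled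
Hessians.

Deterministic part. Let D = ‖z_0 - z⋆‖. If H_k is within τ_k of the true Hessian, the cap on τ_k
forces τ_k ≤ (ρ/4)‖Δz_k‖ (`accuracy_le`). Taylor remainder, model residual and Hessian error then
add up to at most ρ‖Δz_k‖², so F(z_{k+1}) is that close to -6ρ(‖Δx‖Δx, ‖Δy‖Δy), a vector pointing
well against the step. Since λρ‖Δz‖ lies in [1/15, 1/14], `newton_step` gives for every w
λ⟨F(z_{k+1}), z_{k+1} - w⟩ ≤ ½‖ẑ_k - w‖² - ½‖ẑ_{k+1} - w‖² - (1/12)‖Δz_k‖². At w = z⋆ the left side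
is nonnegative by convexity-concavity; hence ẑ_k never moves away from z⋆, and ∑‖Δz_k‖² ≤ 6D² if the
method does not stop. As λ_{k+1} is of order 1/(ρ‖Δz_k‖), a power mean inequality gives ∑λ_k ≥
T^{3/2}/(45ρD). For general w, telescoping and Jensen bound the gap of the average by ½‖z_0 -
w‖²/∑λ_k, which is of order ρD³T^{-3/2}.

Probabilistic part. The tail bound for ‖H_k - ∇²f‖ comes from exchangeable pairs: one entry of the
sample is redrawn. The trace moment M(θ) of the centred sum satisfies M' ≤ (V/2)θM
(`IsExchangeable.sum_exp_inner_le`), by an inequality between exponentials applied entrywise in two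
eigenbases. The argument covers sampling without replacement, because the forbidden moves cancel in
the drift (`sum_injective_update`). Conditionally on the past each iteration fails with probability
at most δ_T, and (1 - δ_T)^T = 1 - δ. -/

/-- The exponential lies below its chords: the logarithmic mean is at most the arithmetic mean. -/
theorem exp_sub_exp_le_of_le {a b : ℝ} (h : b ≤ a) :
    Real.exp a - Real.exp b ≤ (a - b) / 2 * (Real.exp a + Real.exp b) := by
  -- After division by `exp b`, with x = a - b. The derivative of the difference is ((x - 1)eˣ +
  -- 1)/2, which is nonnegative because 1 - x ≤ e⁻ˣ.
  have key : ∀ x : ℝ, 0 ≤ x → 0 ≤ x / 2 * (Real.exp x + 1) - (Real.exp x - 1) := by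
    have hmono : MonotoneOn (fun x : ℝ => x / 2 * (Real.exp x + 1) - (Real.exp x - 1))
        (Set.Ici 0) := by
      apply monotoneOn_of_deriv_nonneg (convex_Ici 0) (by fun_prop) (by fun_prop)
      intro x hx
      rw [interior_Ici] at hx
      have hd : HasDerivAt (fun x : ℝ => x / 2 * (Real.exp x + 1) - (Real.exp x - 1))
          (1 / 2 * (Real.exp x + 1) + x / 2 * Real.exp x - Real.exp x) x :=
        (((hasDerivAt_id x).div_const 2).mul ((Real.hasDerivAt_exp x).add_const 1)).sub
          ((Real.hasDerivAt_exp x).sub_const 1)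
      rw [hd.deriv]
      have h1 : 1 - x ≤ Real.exp (-x) := by linarith [Real.add_one_le_exp (-x)]
      have h2 : Real.exp x * Real.exp (-x) = 1 := by rw [← Real.exp_add]; simp
      nlinarith [mul_le_mul_of_nonneg_left h1 (Real.exp_pos x).le]
    intro x hx
    have := hmono (Set.self_mem_Ici) (Set.mem_Ici.2 hx) hx
    simpa using this
  have h1 := key (a - b) (by linarith)
  have h2 : Real.exp a = Real.exp (a - b) * Real.exp b := by rw [← Real.exp_add]; ring_nf
  rw [h2]
  nlinarith [mul_nonneg h1 (Real.exp_pos b).le]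

/-- Both sides are symmetric in a and b, so the ordered inequality, multiplied by |a - b|, covers
both cases. -/
theorem sub_mul_exp_sub_exp_le {θ : ℝ} (hθ : 0 ≤ θ) (a b : ℝ) :
    (a - b) * (Real.exp (θ * a) - Real.exp (θ * b)) ≤
      θ / 2 * ((a - b) ^ 2 * (Real.exp (θ * a) + Real.exp (θ * b))) := by
  rcases le_total b a with h | h
  · have := exp_sub_exp_le_of_le (mul_le_mul_of_nonneg_left h hθ)
    nlinarith [mul_le_mul_of_nonneg_left this (sub_nonneg.2 h)]
  · have := exp_sub_exp_le_of_le (mul_le_mul_of_nonneg_left h hθ)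
    nlinarith [mul_le_mul_of_nonneg_left this (sub_nonneg.2 h)]

/-! ### Trace inequalities and concentration for exchangeable pairs of symmetric operators -/

section Spectral

variable {E : Type*} [NormedAddCommGroup E] [InnerProductSpace ℝ E] {ι κ : Type*} [Fintype ι]
  [Fintype κ]

/-- Between an eigenvector of one operator and one of the other, the entry of the difference
factors. This makes termwise scalar comparison possible although A and B need not commute. -/
theorem inner_apply_sub_eigen {A B : E →L[ℝ] E} (hB : (B : E →ₗ[ℝ] E).IsSymmetric) {u v : E}
    {a b : ℝ} (hu : A u = a • u) (hv : B v = b • v) : ⟪v, (A - B) u⟫ = (a - b) * ⟪v, u⟫ := by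
  have h1 : ⟪v, B u⟫ = b * ⟪v, u⟫ := by
    have := hB v u
    simp only [ContinuousLinearMap.coe_coe] at this
    rw [← this, hv, real_inner_smul_left]
  rw [sub_apply, inner_sub_right, h1, hu, real_inner_smul_right]
  ring

/-- The mean value trace inequality for the exponential function, written in eigenbases. -/
theorem sum_exp_inner_sub_le {A B : E →L[ℝ] E} (hA : (A : E →ₗ[ℝ] E).IsSymmetric)
    (hB : (B : E →ₗ[ℝ] E).IsSymmetric) (u : OrthonormalBasis ι ℝ E) (v : OrthonormalBasis κ ℝ E)
    {a : ι → ℝ} {b : κ → ℝ} (hu : ∀ i, A (u i) = a i • u i) (hv : ∀ j, B (v j) = b j • v j)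
    {θ : ℝ} (hθ : 0 ≤ θ) :
    ∑ i, Real.exp (θ * a i) * ⟪u i, (A - B) (u i)⟫ + ∑ j, Real.exp (θ * b j) * ⟪v j, (B - A) (v j)⟫ ≤
      θ / 2 * (∑ i, Real.exp (θ * a i) * ‖(A - B) (u i)‖ ^ 2 +
        ∑ j, Real.exp (θ * b j) * ‖(B - A) (v j)‖ ^ 2) := by
  have e1 : ∀ i, ⟪u i, (A - B) (u i)⟫ = ∑ j, (a i - b j) * ⟪v j, u i⟫ ^ 2 := fun i => by
    rw [← v.sum_inner_mul_inner]
    refine Finset.sum_congr rfl fun j _ => ?_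
    rw [inner_apply_sub_eigen hB (hu i) (hv j), real_inner_comm]
    ring
  have e2 : ∀ j, ⟪v j, (B - A) (v j)⟫ = ∑ i, (b j - a i) * ⟪v j, u i⟫ ^ 2 := fun j => by
    rw [← u.sum_inner_mul_inner]
    refine Finset.sum_congr rfl fun i _ => ?_
    rw [inner_apply_sub_eigen hA (hv j) (hu i), real_inner_comm (v j) (u i)]
    ring
  have e3 : ∀ i, ‖(A - B) (u i)‖ ^ 2 = ∑ j, (a i - b j) ^ 2 * ⟪v j, u i⟫ ^ 2 := fun i => by
    rw [← v.sum_sq_norm_inner_right]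
    refine Finset.sum_congr rfl fun j _ => ?_
    rw [inner_apply_sub_eigen hB (hu i) (hv j), Real.norm_eq_abs, sq_abs, mul_pow]
  have e4 : ∀ j, ‖(B - A) (v j)‖ ^ 2 = ∑ i, (b j - a i) ^ 2 * ⟪v j, u i⟫ ^ 2 := fun j => by
    rw [← u.sum_sq_norm_inner_right]
    refine Finset.sum_congr rfl fun i _ => ?_
    rw [inner_apply_sub_eigen hA (hv j) (hu i), Real.norm_eq_abs, sq_abs, mul_pow,
      real_inner_comm]
  -- Both sides are now double sums over (i, j) with the common weight ⟪v j, u i⟫², and the scalar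
  -- inequality applies term by term.
  simp only [e1, e2, e3, e4, Finset.mul_sum]
  rw [Finset.sum_comm (s := (Finset.univ : Finset κ)), Finset.sum_comm (s := (Finset.univ : Finset κ)),
    ← Finset.sum_add_distrib, ← Finset.sum_add_distrib, Finset.mul_sum]
  refine Finset.sum_le_sum fun i _ => ?_
  rw [← Finset.sum_add_distrib, ← Finset.sum_add_distrib, Finset.mul_sum]
  refine Finset.sum_le_sum fun j _ => ?_
  nlinarith [mul_le_mul_of_nonneg_right (sub_mul_exp_sub_exp_le hθ (a i) (b j))
    (sq_nonneg ⟪v j, u i⟫)]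

/-- The data of an exchangeable pair: `X` is a family of symmetric operators with eigenbases `u l`
and eigenvalues `a l`, indexed by a finite set of configurations `l` of weight `q l`; a move `k`
from `l`, of weight `w (l, k)`, leads to the configuration `(σ (l, k)).1`, and `σ` reverses it. -/
structure IsExchangeable {Λ : Type*} [Fintype Λ] (X : Λ → E →L[ℝ] E)
    (q : Λ → ℝ) (w : Λ × κ → ℝ) (σ : Λ × κ → Λ × κ) (V : ℝ) : Prop where
  q_nonneg : ∀ l, 0 ≤ q l
  w_nonneg : ∀ p, 0 ≤ w p
  invol : Function.Involutive σ
  w_symm : ∀ p, w (σ p) = w p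
  -- The regression condition of a Stein pair. The weights are not normalised: the usual regression
  -- constant is absorbed into w, and correspondingly into V.
  drift : ∀ l, ∑ k, w (l, k) • (X l - X (σ (l, k)).1) = q l • X l
  variance : ∀ l, ∑ k, w (l, k) * ‖X l - X (σ (l, k)).1‖ ^ 2 ≤ V * q l
  symm : ∀ l, (X l : E →ₗ[ℝ] E).IsSymmetric

theorem IsExchangeable.neg {Λ : Type*} [Fintype Λ] {X : Λ → E →L[ℝ] E}
    {q : Λ → ℝ} {w : Λ × κ → ℝ} {σ : Λ × κ → Λ × κ} {V : ℝ} (h : IsExchangeable X q w σ V) :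
    IsExchangeable (fun l => -X l) q w σ V where
  q_nonneg := h.q_nonneg
  w_nonneg := h.w_nonneg
  invol := h.invol
  w_symm := h.w_symm
  drift l := by
    have := h.drift l
    rw [smul_neg, ← this, ← Finset.sum_neg_distrib]
    refine Finset.sum_congr rfl fun k _ => ?_
    rw [← smul_neg]
    congr 1
    abel
  variance l := by
    refine le_trans (le_of_eq ?_) (h.variance l)
    refine Finset.sum_congr rfl fun k _ => ?_
    rw [← norm_neg]
    congr 3
    abel
  symm l x y := by
    have := h.symm l x y
    simp only [ContinuousLinearMap.coe_coe] at this
    simp [this]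

/-- With M(θ) the q-weighted trace of exp(θX), this is the differential inequality M' ≤ (V/2)θM. The
drift rewrites qX through increments. Averaging over the involution σ pairs each increment with its
negative, and the mean value trace inequality then trades the pair for θ times squared increments,
which `variance` controls. -/
theorem IsExchangeable.sum_exp_inner_le {Λ : Type*} [Fintype Λ] {X : Λ → E →L[ℝ] E}
    {q : Λ → ℝ} {w : Λ × κ → ℝ} {σ : Λ × κ → Λ × κ} {V : ℝ} (h : IsExchangeable X q w σ V)
    (u : Λ → OrthonormalBasis ι ℝ E) {a : Λ → ι → ℝ} (hu : ∀ l i, X l (u l i) = a l i • u l i)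
    {θ : ℝ} (hθ : 0 ≤ θ) :
    ∑ l, q l * ∑ i, a l i * Real.exp (θ * a l i) ≤
      V / 2 * θ * ∑ l, q l * ∑ i, Real.exp (θ * a l i) := by
  set D : Λ × κ → E →L[ℝ] E := fun p => X p.1 - X (σ p).1 with hD
  set L : Λ × κ → ℝ := fun p => ∑ i, Real.exp (θ * a p.1 i) * ⟪u p.1 i, D p (u p.1 i)⟫ with hL
  set Q : Λ × κ → ℝ := fun p => ∑ i, Real.exp (θ * a p.1 i) * ‖D p (u p.1 i)‖ ^ 2 with hQ
  have hinv : ∀ g : Λ × κ → ℝ, ∑ p, w p * g (σ p) = ∑ p, w p * g p := fun g => by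
    rw [← Equiv.sum_comp (h.invol.toPerm σ)]
    refine Finset.sum_congr rfl fun p _ => ?_
    simp [h.invol p, h.w_symm]
  have hlhs : ∑ l, q l * ∑ i, a l i * Real.exp (θ * a l i) = ∑ p, w p * L p := by
    rw [Fintype.sum_prod_type]
    refine Finset.sum_congr rfl fun l _ => ?_
    simp only [hL, Finset.mul_sum]
    rw [Finset.sum_comm]
    refine Finset.sum_congr rfl fun i _ => ?_
    have h1 : ⟪u l i, (q l • X l) (u l i)⟫ = q l * a l i := by
      simp [hu, real_inner_smul_right]
    rw [← h.drift l, sum_apply, inner_sum] at h1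
    simp only [smul_apply, real_inner_smul_right] at h1
    rw [← mul_assoc, ← h1, Finset.sum_mul]
    refine Finset.sum_congr rfl fun k _ => ?_
    simp only [hD]
    ring
  have hmv : ∀ p, L p + L (σ p) ≤ θ / 2 * (Q p + Q (σ p)) := fun p => by
    have := sum_exp_inner_sub_le (h.symm p.1) (h.symm (σ p).1) (u p.1) (u (σ p).1) (hu p.1)
      (hu (σ p).1) hθ
    simpa only [hL, hQ, hD, h.invol p] using this
  have hsum : ∑ p, w p * L p ≤ θ / 2 * ∑ p, w p * Q p := by
    have h1 : ∑ p, w p * (L p + L (σ p)) ≤ ∑ p, w p * (θ / 2 * (Q p + Q (σ p))) :=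
      Finset.sum_le_sum fun p _ => mul_le_mul_of_nonneg_left (hmv p) (h.w_nonneg p)
    have h2 : ∑ p, w p * (L p + L (σ p)) = 2 * ∑ p, w p * L p := by
      simp only [mul_add, Finset.sum_add_distrib, hinv L]; ring
    have h3 : ∑ p, w p * (θ / 2 * (Q p + Q (σ p))) = 2 * (θ / 2 * ∑ p, w p * Q p) := by
      have : ∀ p, w p * (θ / 2 * (Q p + Q (σ p))) =
        θ / 2 * (w p * Q p) + θ / 2 * (w p * Q (σ p)) := fun p => by ring
      simp only [this, Finset.sum_add_distrib, ← Finset.mul_sum, hinv Q]; ring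
    linarith
  rw [hlhs]
  refine hsum.trans ?_
  have hq : ∑ p, w p * Q p ≤ V * ∑ l, q l * ∑ i, Real.exp (θ * a l i) := by
    rw [Fintype.sum_prod_type, Finset.mul_sum]
    refine Finset.sum_le_sum fun l _ => ?_
    have h1 : ∀ k, w (l, k) * Q (l, k) ≤
        w (l, k) * ‖X l - X (σ (l, k)).1‖ ^ 2 * ∑ i, Real.exp (θ * a l i) := fun k => by
      rw [mul_assoc]
      refine mul_le_mul_of_nonneg_left ?_ (h.w_nonneg _)
      rw [Finset.mul_sum]
      refine Finset.sum_le_sum fun i _ => ?_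
      rw [mul_comm]
      refine mul_le_mul_of_nonneg_right ?_ (Real.exp_pos _).le
      gcongr
      simpa using (D (l, k)).le_opNorm (u l i)
    refine (Finset.sum_le_sum fun k _ => h1 k).trans ?_
    rw [← Finset.sum_mul, ← mul_assoc]
    exact mul_le_mul_of_nonneg_right (h.variance l)
      (Finset.sum_nonneg fun i _ => (Real.exp_pos _).le)
  nlinarith [mul_le_mul_of_nonneg_left hq (half_pos zero_lt_two).le]

/-- The exponential moment bound for an exchangeable pair. -/
theorem IsExchangeable.sum_exp_le {Λ : Type*} [Fintype Λ] {X : Λ → E →L[ℝ] E}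
    {q : Λ → ℝ} {w : Λ × κ → ℝ} {σ : Λ × κ → Λ × κ} {V : ℝ} (h : IsExchangeable X q w σ V)
    (u : Λ → OrthonormalBasis ι ℝ E) {a : Λ → ι → ℝ} (hu : ∀ l i, X l (u l i) = a l i • u l i)
    {θ : ℝ} (hθ : 0 ≤ θ) :
    ∑ l, q l * ∑ i, Real.exp (θ * a l i) ≤
      (∑ l, q l) * Fintype.card ι * Real.exp (V / 4 * θ ^ 2) := by
  set M : ℝ → ℝ := fun θ => ∑ l, q l * ∑ i, Real.exp (θ * a l i) with hM
  have hMd : ∀ θ, HasDerivAt M (∑ l, q l * ∑ i, a l i * Real.exp (θ * a l i)) θ := fun θ => by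
    refine HasDerivAt.fun_sum fun l _ => HasDerivAt.const_mul _ (HasDerivAt.fun_sum fun i _ => ?_)
    have := ((hasDerivAt_id θ).mul_const (a l i)).exp
    simpa [mul_comm] using this
  have hGd : ∀ θ, HasDerivAt (fun θ => Real.exp (-(V / 4 * θ ^ 2)))
      (Real.exp (-(V / 4 * θ ^ 2)) * (-(V / 4 * (2 * θ)))) θ := fun θ => by
    have := (((hasDerivAt_pow 2 θ).const_mul (V / 4)).neg).exp
    simpa using this
  -- Grönwall: the differential inequality makes M(θ)exp(-Vθ²/4) nonincreasing, and M(0) is the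
  -- total mass times the dimension.
  have hanti : AntitoneOn (fun θ => M θ * Real.exp (-(V / 4 * θ ^ 2))) (Set.Ici 0) := by
    have hd := fun θ => (hMd θ).mul (hGd θ)
    refine antitoneOn_of_deriv_nonpos (convex_Ici 0)
      (fun θ _ => (hd θ).continuousAt.continuousWithinAt)
      (fun θ _ => (hd θ).differentiableAt.differentiableWithinAt) fun x hx => ?_
    rw [interior_Ici] at hx
    have h1 := h.sum_exp_inner_le u hu (le_of_lt (Set.mem_Ioi.1 hx))
    refine (le_of_eq (hd x).deriv).trans ?_
    have h2 := mul_le_mul_of_nonneg_right h1 (Real.exp_pos (-(V / 4 * x ^ 2))).le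
    simp only [hM]
    nlinarith
  have h0 := hanti Set.self_mem_Ici (Set.mem_Ici.2 hθ) hθ
  simp only [hM, zero_mul, Real.exp_zero, Finset.sum_const, Finset.card_univ, nsmul_eq_mul, mul_one,
    ne_eq, OfNat.ofNat_ne_zero, not_false_eq_true, zero_pow, mul_zero, neg_zero] at h0
  rw [← Finset.sum_mul] at h0
  have h3 := mul_le_mul_of_nonneg_right h0 (Real.exp_pos (V / 4 * θ ^ 2)).le
  rw [mul_assoc, ← Real.exp_add] at h3
  simpa using h3

/-- The norm of an operator with an orthonormal eigenbasis is at most the largest |a i|, so some |a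
i| exceeds t; that eigenvalue alone contributes enough to the trace of exp(θA) or to that of
exp(-θA). -/
theorem exp_mul_norm_le_sum_exp_add {A : E →L[ℝ] E} (u : OrthonormalBasis ι ℝ E)
    {a : ι → ℝ} (hu : ∀ i, A (u i) = a i • u i) {θ t : ℝ} (hθ : 0 ≤ θ) (ht : t < ‖A‖) (ht0 : 0 ≤ t) :
    Real.exp (θ * t) ≤ ∑ i, Real.exp (θ * a i) + ∑ i, Real.exp (θ * -a i) := by
  obtain ⟨i, hi⟩ : ∃ i, t < |a i| := by
    by_contra! hcon
    refine absurd ht (not_lt.2 (A.opNorm_le_bound ht0 fun x => ?_))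
    refine le_of_sq_le_sq ?_ (by positivity)
    have h1 : A x = ∑ i, (⟪u i, x⟫ * a i) • u i := by
      conv_lhs => rw [← u.sum_repr' x]
      simp [map_sum, hu, smul_smul]
    rw [h1, ← u.sum_sq_norm_inner_right, mul_pow, ← u.sum_sq_norm_inner_right x, Finset.mul_sum]
    refine Finset.sum_le_sum fun i _ => ?_
    rw [u.orthonormal.inner_right_fintype]
    rw [norm_mul, mul_pow, mul_comm, Real.norm_eq_abs (a i)]
    gcongr
    exact hcon i
  have hsingle : ∀ b : ι → ℝ, Real.exp (θ * b i) ≤ ∑ i, Real.exp (θ * b i) := fun b =>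
    Finset.single_le_sum (f := fun i => Real.exp (θ * b i)) (fun i _ => (Real.exp_pos _).le)
      (Finset.mem_univ i)
  have hnn : ∀ b : ι → ℝ, 0 ≤ ∑ i, Real.exp (θ * b i) := fun b =>
    Finset.sum_nonneg fun i _ => (Real.exp_pos _).le
  rcases le_total 0 (a i) with hs | hs
  · rw [abs_of_nonneg hs] at hi
    have := hsingle a
    have h2 : Real.exp (θ * t) ≤ Real.exp (θ * a i) := by gcongr
    linarith [hnn fun i => -a i]
  · rw [abs_of_nonpos hs] at hi
    have := hsingle fun i => -a i
    have h2 : Real.exp (θ * t) ≤ Real.exp (θ * -a i) := by gcongr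
    linarith [hnn a]

open Classical in
/-- The tail bound for an exchangeable pair of symmetric operators. -/
theorem IsExchangeable.tail_le [FiniteDimensional ℝ E] {Λ : Type*} [Fintype Λ] {X : Λ → E →L[ℝ] E}
    {q : Λ → ℝ} {w : Λ × κ → ℝ} {σ : Λ × κ → Λ × κ} {V : ℝ} (h : IsExchangeable X q w σ V)
    (hq : ∑ l, q l ≤ 1) (hV : 0 < V) {t : ℝ} (ht : 0 ≤ t) :
    ∑ l, (if t < ‖X l‖ then q l else 0) ≤
      2 * (Module.finrank ℝ E : ℝ) * Real.exp (-(t ^ 2 / V)) := by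
  set u : ∀ l, OrthonormalBasis (Fin (Module.finrank ℝ E)) ℝ E :=
    fun l => (h.symm l).eigenvectorBasis rfl
  set a : Λ → Fin (Module.finrank ℝ E) → ℝ := fun l => (h.symm l).eigenvalues rfl
  have hu : ∀ l i, X l (u l i) = a l i • u l i := fun l i => by
    exact (h.symm l).apply_eigenvectorBasis rfl i
  -- The minimiser of Vθ²/4 - θt, with minimum -t²/V.
  set θ : ℝ := 2 * t / V with hθdef
  have hθ : 0 ≤ θ := by positivity
  have h1 := h.sum_exp_le u hu hθ
  have h2 := h.neg.sum_exp_le u (a := fun l i => -a l i) (fun l i => by simp [hu]) hθ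
  have h3 : (∑ l, (if t < ‖X l‖ then q l else 0)) * Real.exp (θ * t) ≤
      ∑ l, q l * ∑ i, Real.exp (θ * a l i) + ∑ l, q l * ∑ i, Real.exp (θ * -a l i) := by
    rw [Finset.sum_mul, ← Finset.sum_add_distrib]
    refine Finset.sum_le_sum fun l _ => ?_
    rw [← mul_add]
    split_ifs with hl
    · exact mul_le_mul_of_nonneg_left (exp_mul_norm_le_sum_exp_add (u l) (hu l) hθ hl ht)
        (h.q_nonneg l)
    · rw [zero_mul]
      exact mul_nonneg (h.q_nonneg l) (add_nonneg
        (Finset.sum_nonneg fun i _ => (Real.exp_pos _).le)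
        (Finset.sum_nonneg fun i _ => (Real.exp_pos _).le))
  rw [Fintype.card_fin] at h1 h2
  have h4 : (∑ l, q l) * (Module.finrank ℝ E : ℝ) * Real.exp (V / 4 * θ ^ 2) ≤
      1 * (Module.finrank ℝ E : ℝ) * Real.exp (V / 4 * θ ^ 2) := by gcongr
  have h5 : (∑ l, (if t < ‖X l‖ then q l else 0)) * Real.exp (θ * t) ≤
      2 * (Module.finrank ℝ E : ℝ) * Real.exp (V / 4 * θ ^ 2) := by linarith
  have h6 : Real.exp (V / 4 * θ ^ 2) = Real.exp (-(t ^ 2 / V)) * Real.exp (θ * t) := by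
    rw [← Real.exp_add]
    congr 1
    rw [hθdef]
    field_simp
    ring
  rw [h6, ← mul_assoc] at h5
  exact le_of_mul_le_mul_right h5 (Real.exp_pos _)

end Spectral

/-! ### Exchangeable pairs from sampling with and without replacement -/

section Sampling

variable {E : Type*} [NormedAddCommGroup E] [InnerProductSpace ℝ E] {N s : ℕ}

/-- The centred sum over a sample. -/
def centredSum (Y : Fin N → E →L[ℝ] E) (M : E →L[ℝ] E) (l : Fin s → Fin N) : E →L[ℝ] E :=
  ∑ k, (Y (l k) - M)

/-- The move that replaces the `k`-th entry of a sample, with the data of the reverse move. -/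
def resample (p : (Fin s → Fin N) × (Fin s × Fin N)) : (Fin s → Fin N) × (Fin s × Fin N) :=
  (Function.update p.1 p.2.1 p.2.2, (p.2.1, p.1 p.2.1))

theorem resample_involutive : Function.Involutive (resample : (Fin s → Fin N) × _ → _) := by
  rintro ⟨l, k, j⟩
  simp [resample]

theorem centredSum_sub_resample (Y : Fin N → E →L[ℝ] E) (M : E →L[ℝ] E) (l : Fin s → Fin N)
    (k : Fin s) (j : Fin N) :
    centredSum Y M l - centredSum Y M (resample (l, (k, j))).1 = Y (l k) - Y j := by
  unfold centredSum resample
  rw [← Finset.sum_sub_distrib, Finset.sum_eq_single k]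
  · simp
  · intro b _ hb
    simp [Function.update_of_ne hb]
  · simp

theorem isSymmetric_centredSum {Y : Fin N → E →L[ℝ] E} {M : E →L[ℝ] E}
    (hY : ∀ i, (Y i : E →ₗ[ℝ] E).IsSymmetric) (hM : (M : E →ₗ[ℝ] E).IsSymmetric)
    (l : Fin s → Fin N) : (centredSum Y M l : E →ₗ[ℝ] E).IsSymmetric := by
  intro x y
  have h1 : ∀ i, ⟪Y i x, y⟫ = ⟪x, Y i y⟫ := fun i => hY i x y
  have h2 : ⟪M x, y⟫ = ⟪x, M y⟫ := hM x y
  simp only [centredSum, ContinuousLinearMap.coe_coe, sum_apply, sub_apply,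
    sum_inner, inner_sum, inner_sub_left, inner_sub_right, h1, h2]

theorem norm_sub_sq_le {A B : E →L[ℝ] E} {W : ℝ} (hA : ‖A‖ ≤ W) (hB : ‖B‖ ≤ W) :
    ‖A - B‖ ^ 2 ≤ 4 * W ^ 2 := by
  have h1 : ‖A - B‖ ≤ 2 * W := (norm_sub_le A B).trans (by linarith)
  nlinarith [norm_nonneg (A - B)]

theorem sum_prod_eq_one {p : Fin N → ℝ} (hp1 : ∑ i, p i = 1) :
    ∑ l : Fin s → Fin N, ∏ k, p (l k) = 1 := by
  have := Finset.prod_univ_sum (fun _ : Fin s => (Finset.univ : Finset (Fin N)))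
    (fun _ i => p i)
  rw [Fintype.piFinset_univ] at this
  rw [← this]
  simp [hp1]

/-- Redrawing position k gives the mean increment Y (l k) - M, and the sum over k is the centred sum
itself. Each increment has norm at most 2W and there are s positions, whence V = 4sW². -/
theorem isExchangeable_withReplacement {Y : Fin N → E →L[ℝ] E} {M : E →L[ℝ] E}
    (hY : ∀ i, (Y i : E →ₗ[ℝ] E).IsSymmetric) (hM : (M : E →ₗ[ℝ] E).IsSymmetric)
    {W : ℝ} (hW : ∀ i, ‖Y i‖ ≤ W) {p : Fin N → ℝ} (hp : ∀ i, 0 ≤ p i) (hp1 : ∑ i, p i = 1)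
    (hmean : ∑ i, p i • Y i = M) :
    IsExchangeable (centredSum (s := s) Y M) (fun l => ∏ k, p (l k))
      (fun x => (∏ k, p (x.1 k)) * p x.2.2) resample (s * (4 * W ^ 2)) where
  q_nonneg l := Finset.prod_nonneg fun k _ => hp _
  w_nonneg x := mul_nonneg (Finset.prod_nonneg fun k _ => hp _) (hp _)
  invol := resample_involutive
  w_symm := by
    rintro ⟨l, k, j⟩
    simp only [resample]
    rw [← Finset.mul_prod_erase _ _ (Finset.mem_univ k),
      ← Finset.mul_prod_erase _ (fun k => p (l k)) (Finset.mem_univ k)]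
    have : ∀ i ∈ Finset.univ.erase k, p (Function.update l k j i) = p (l i) := fun i hi => by
      rw [Function.update_of_ne (Finset.ne_of_mem_erase hi)]
    rw [Finset.prod_congr rfl this, Function.update_self]
    ring
  drift l := by
    rw [Fintype.sum_prod_type]
    simp only [centredSum_sub_resample, mul_smul, ← Finset.smul_sum]
    congr 1
    refine Finset.sum_congr rfl fun k _ => ?_
    simp only [smul_sub, Finset.sum_sub_distrib, hmean]
    rw [← Finset.sum_smul, hp1, one_smul]
  variance l := by
    have h1 : ∀ x : Fin s × Fin N, (∏ k, p (l k)) * p x.2 *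
        ‖centredSum Y M l - centredSum Y M (resample (l, x)).1‖ ^ 2 ≤
        (∏ k, p (l k)) * p x.2 * (4 * W ^ 2) := fun ⟨k, j⟩ => by
      rw [centredSum_sub_resample]
      exact mul_le_mul_of_nonneg_left (norm_sub_sq_le (hW _) (hW _))
        (mul_nonneg (Finset.prod_nonneg fun k _ => hp _) (hp _))
    refine (Finset.sum_le_sum fun x _ => h1 x).trans (le_of_eq ?_)
    rw [← Finset.sum_mul, ← Finset.mul_sum, Fintype.sum_prod_type]
    simp only [hp1, Finset.sum_const, Finset.card_univ, Fintype.card_fin, nsmul_eq_mul]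
    ring
  symm := isSymmetric_centredSum hY hM

open Classical in
-- The injective samples are counted by `Nat.descFactorial`. The inequality is not always an
-- equality: for s > N there are none, and the sum is 0.
theorem sum_ite_injective_le_one :
    ∑ l : Fin s → Fin N,
      (if Function.Injective l then ((N.descFactorial s : ℕ) : ℝ)⁻¹ else 0) ≤ 1 := by
  rw [← Finset.sum_filter, Finset.sum_const, nsmul_eq_mul]
  have h1 : (Finset.univ.filter fun l : Fin s → Fin N => Function.Injective l).card =
      N.descFactorial s := by
    rw [← Fintype.card_subtype,
      Fintype.card_congr (Equiv.subtypeInjectiveEquivEmbedding (Fin s) (Fin N)),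
      Fintype.card_embedding_eq, Fintype.card_fin, Fintype.card_fin]
  rw [h1]
  exact mul_inv_le_one

theorem injective_update_iff {l : Fin s → Fin N} (hl : Function.Injective l) (k : Fin s)
    (j : Fin N) : Function.Injective (Function.update l k j) ↔ ∀ k', l k' = j → k' = k := by
  constructor
  · intro h k' hk'
    by_contra hne
    exact hne (h (by rw [Function.update_of_ne hne, Function.update_self, hk']))
  · intro h a b hab
    by_cases ha : a = k <;> by_cases hb : b = k
    · rw [ha, hb]
    · rw [ha, Function.update_self, Function.update_of_ne hb] at hab
      exact absurd (h b hab.symm) hb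
    · rw [hb, Function.update_self, Function.update_of_ne ha] at hab
      exact absurd (h a hab) ha
    · rw [Function.update_of_ne ha, Function.update_of_ne hb] at hab
      exact hl hab

open Classical in
-- The forbidden moves put another entry l k' of the sample into position k. Their contributions Y
-- (l k) - Y (l k') are antisymmetric in (k, k') and cancel in the sum, so discarding them does not
-- change the drift.
theorem sum_injective_update {F : Type*} [AddCommGroup F] {l : Fin s → Fin N}
    (hl : Function.Injective l) (Y : Fin N → F) :
    ∑ k, ∑ j, (if Function.Injective (Function.update l k j) then Y (l k) - Y j else 0) =
      ∑ k, ∑ j, (Y (l k) - Y j) := by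
  have h1 : ∀ k, ∑ j, (if Function.Injective (Function.update l k j) then Y (l k) - Y j else 0) =
      ∑ j, (Y (l k) - Y j) - ∑ k', (Y (l k) - Y (l k')) := fun k => by
    have h2 : ∑ k', (Y (l k) - Y (l k')) =
        ∑ j, if j ∈ Finset.univ.image l then Y (l k) - Y j else 0 := by
      rw [← Finset.sum_filter, Finset.filter_mem_eq_inter, Finset.univ_inter,
        Finset.sum_image fun a _ b _ h => hl h]
    rw [h2, ← Finset.sum_sub_distrib]
    refine Finset.sum_congr rfl fun j _ => ?_
    simp only [injective_update_iff hl]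
    by_cases hj : ∃ k', l k' = j
    · obtain ⟨k', rfl⟩ := hj
      have : l k' ∈ Finset.univ.image l := Finset.mem_image_of_mem _ (Finset.mem_univ _)
      rw [if_pos this, sub_self]
      split_ifs with h
      · rw [h k' rfl, sub_self]
      · rfl
    · push Not at hj
      rw [if_pos fun k' hk' => absurd hk' (hj k'), if_neg, sub_zero]
      simpa using hj
  simp only [h1, Finset.sum_sub_distrib]
  have h3 : ∑ k : Fin s, ∑ _k' : Fin s, Y (l k) = ∑ _k : Fin s, ∑ k', Y (l k') := Finset.sum_comm
  rw [h3, sub_self, sub_zero]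

open Classical in
-- Only moves between injective samples get weight; the weight is symmetric because q is constant on
-- those samples. By `sum_injective_update` the drift is the same as with replacement, so the same V
-- works.
theorem isExchangeable_withoutReplacement (hN : 0 < N) {Y : Fin N → E →L[ℝ] E} {M : E →L[ℝ] E}
    (hY : ∀ i, (Y i : E →ₗ[ℝ] E).IsSymmetric) (hM : (M : E →ₗ[ℝ] E).IsSymmetric)
    {W : ℝ} (hW : ∀ i, ‖Y i‖ ≤ W) (hmean : ∑ i, (1 / (N : ℝ)) • Y i = M) :
    IsExchangeable (centredSum (s := s) Y M)
      (fun l => if Function.Injective l then ((N.descFactorial s : ℕ) : ℝ)⁻¹ else 0)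
      (fun x => if Function.Injective x.1 ∧ Function.Injective (Function.update x.1 x.2.1 x.2.2)
        then 1 / (N : ℝ) * ((N.descFactorial s : ℕ) : ℝ)⁻¹ else 0)
      resample (s * (4 * W ^ 2)) where
  q_nonneg l := by positivity
  w_nonneg x := by positivity
  invol := resample_involutive
  w_symm := by
    rintro ⟨l, k, j⟩
    simp only [resample, Function.update_idem, Function.update_eq_self]
    simp only [and_comm]
  drift l := by
    rw [Fintype.sum_prod_type]
    simp only [centredSum_sub_resample]
    by_cases hl : Function.Injective l
    · have hNR : (N : ℝ) ≠ 0 := by positivity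
      simp only [hl, true_and, if_true]
      have h1 : ∀ k j, (if Function.Injective (Function.update l k j)
          then 1 / (N : ℝ) * ((N.descFactorial s : ℕ) : ℝ)⁻¹ else 0) • (Y (l k) - Y j) =
          (((N.descFactorial s : ℕ) : ℝ)⁻¹ * (1 / (N : ℝ))) •
            (if Function.Injective (Function.update l k j) then Y (l k) - Y j else 0) :=
        fun k j => by split_ifs <;> simp [mul_comm]
      simp only [h1, ← Finset.smul_sum]
      rw [sum_injective_update hl, mul_smul, Finset.smul_sum]
      congr 1
      refine Finset.sum_congr rfl fun k _ => ?_
      rw [Finset.smul_sum]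
      simp only [smul_sub, Finset.sum_sub_distrib, hmean]
      simp only [Finset.sum_const, Finset.card_univ, Fintype.card_fin]
      rw [← Nat.cast_smul_eq_nsmul ℝ, smul_smul, mul_one_div_cancel hNR, one_smul]
    · simp [hl]
  variance l := by
    by_cases hl : Function.Injective l
    · simp only [hl, true_and, if_true]
      have h1 : ∀ x : Fin s × Fin N, (if Function.Injective (Function.update l x.1 x.2)
          then 1 / (N : ℝ) * ((N.descFactorial s : ℕ) : ℝ)⁻¹ else 0) *
          ‖centredSum Y M l - centredSum Y M (resample (l, x)).1‖ ^ 2 ≤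
          1 / (N : ℝ) * ((N.descFactorial s : ℕ) : ℝ)⁻¹ * (4 * W ^ 2) := fun ⟨k, j⟩ => by
        rw [centredSum_sub_resample]
        refine mul_le_mul ?_ (norm_sub_sq_le (hW _) (hW _)) (by positivity) (by positivity)
        split_ifs
        · exact le_rfl
        · positivity
      refine (Finset.sum_le_sum fun x _ => h1 x).trans (le_of_eq ?_)
      simp only [Finset.sum_const, Finset.card_univ, Fintype.card_prod, Fintype.card_fin,
        nsmul_eq_mul, Nat.cast_mul]
      field_simp
    · simp [hl]
  symm := isSymmetric_centredSum hY hM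

/-- The failure probability is at most `δ` once the sample is large enough. -/
theorem two_mul_exp_le {d s W τ δ : ℝ} (hd : 0 ≤ d) (hs : 0 < s) (hW : 0 < W) (hτ : 0 < τ)
    (hδ : 0 < δ) (h : 4 * W ^ 2 / τ ^ 2 * Real.log (2 * d / δ) ≤ s) :
    2 * d * Real.exp (-((s * τ) ^ 2 / (s * (4 * W ^ 2)))) ≤ δ := by
  rcases hd.eq_or_lt with rfl | hd
  · simp [hδ.le]
  -- The exponent equals sτ²/(4W²), so the size condition says that it dominates the logarithm.
  have h1 : Real.log (2 * d / δ) ≤ (s * τ) ^ 2 / (s * (4 * W ^ 2)) := by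
    rw [le_div_iff₀ (by positivity)]
    rw [div_mul_eq_mul_div, div_le_iff₀ (by positivity)] at h
    nlinarith
  have h2 : 2 * d / δ ≤ Real.exp ((s * τ) ^ 2 / (s * (4 * W ^ 2))) := by
    rwa [← Real.log_le_iff_le_exp (by positivity)]
  rw [Real.exp_neg, ← div_eq_mul_inv, div_le_iff₀ (Real.exp_pos _)]
  rwa [div_le_iff₀ hδ, mul_comm _ δ] at h2

/-- The case W = 0, where V = 0 and the tail bound for exchangeable pairs does not apply. -/
theorem centredSum_eq_zero {Y : Fin N → E →L[ℝ] E} {M : E →L[ℝ] E} {p : Fin N → ℝ}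
    (hmean : ∑ i, p i • Y i = M) (hY : ∀ i, ‖Y i‖ ≤ 0) (l : Fin s → Fin N) :
    centredSum Y M l = 0 := by
  have h0 : ∀ i, Y i = 0 := fun i => norm_le_zero_iff.1 (hY i)
  have hM : M = 0 := by rw [← hmean]; simp [h0]
  simp [centredSum, h0, hM]

variable [FiniteDimensional ℝ E]

open Classical in
theorem sum_withReplacement_le {Y : Fin N → E →L[ℝ] E} {M : E →L[ℝ] E}
    (hY : ∀ i, (Y i : E →ₗ[ℝ] E).IsSymmetric) (hM : (M : E →ₗ[ℝ] E).IsSymmetric)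
    {W : ℝ} (hW0 : 0 ≤ W) (hW : ∀ i, ‖Y i‖ ≤ W) {p : Fin N → ℝ} (hp : ∀ i, 0 ≤ p i)
    (hp1 : ∑ i, p i = 1) (hmean : ∑ i, p i • Y i = M) {τ δ : ℝ} (hτ : 0 < τ) (hδ : 0 < δ)
    (hs : 0 < s)
    (hsize : 4 * W ^ 2 / τ ^ 2 * Real.log (2 * (Module.finrank ℝ E : ℝ) / δ) ≤ s) :
    ∑ l : Fin s → Fin N, (if s * τ < ‖centredSum Y M l‖ then ∏ k, p (l k) else 0) ≤ δ := by
  have hsR : (0 : ℝ) < s := by exact_mod_cast hs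
  rcases hW0.eq_or_lt with rfl | hW0
  · have h1 : ¬ (s * τ < 0) := not_lt.2 (by positivity)
    simp [centredSum_eq_zero hmean hW, h1, hδ.le]
  · exact ((isExchangeable_withReplacement hY hM hW hp hp1 hmean).tail_le
      (sum_prod_eq_one hp1).le (by positivity) (by positivity)).trans
      (two_mul_exp_le (by positivity) hsR hW0 hτ hδ hsize)

open Classical in
theorem sum_withoutReplacement_le (hN : 0 < N) {Y : Fin N → E →L[ℝ] E} {M : E →L[ℝ] E}
    (hY : ∀ i, (Y i : E →ₗ[ℝ] E).IsSymmetric) (hM : (M : E →ₗ[ℝ] E).IsSymmetric)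
    {W : ℝ} (hW0 : 0 ≤ W) (hW : ∀ i, ‖Y i‖ ≤ W) (hmean : ∑ i, (1 / (N : ℝ)) • Y i = M)
    {τ δ : ℝ} (hτ : 0 < τ) (hδ : 0 < δ) (hs : 0 < s)
    (hsize : 4 * W ^ 2 / τ ^ 2 * Real.log (2 * (Module.finrank ℝ E : ℝ) / δ) ≤ s) :
    ∑ l : Fin s → Fin N, (if s * τ < ‖centredSum Y M l‖ then
      (if Function.Injective l then ((N.descFactorial s : ℕ) : ℝ)⁻¹ else 0) else 0) ≤ δ := by
  have hsR : (0 : ℝ) < s := by exact_mod_cast hs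
  rcases hW0.eq_or_lt with rfl | hW0
  · have h1 : ¬ (s * τ < 0) := not_lt.2 (by positivity)
    simp [centredSum_eq_zero hmean hW, h1, hδ.le]
  · exact ((isExchangeable_withoutReplacement hN hY hM hW hmean).tail_le
      sum_ite_injective_le_one (by positivity) (by positivity)).trans
      (two_mul_exp_le (by positivity) hsR hW0 hτ hδ hsize)

end Sampling

/-- A sum over lists that lives on the lists of length `s` is a sum over functions on `Fin s`. -/
theorem tsum_list_eq_sum_ofFn {N s : ℕ} {g : List (Fin N) → ℝ} (hg : ∀ l, l.length ≠ s → g l = 0)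
    (hg0 : ∀ l, 0 ≤ g l) :
    ∑' l, ENNReal.ofReal (g l) =
      ENNReal.ofReal (∑ l : Fin s → Fin N, g (List.ofFn l)) := by
  rw [ENNReal.ofReal_sum_of_nonneg fun l _ => hg0 _, ← tsum_fintype (L := .unconditional _)]
  refine ((List.ofFn_injective (α := Fin N) (n := s)).tsum_eq fun l hl => ?_).symm
  by_cases h : l.length = s
  · subst h
    exact ⟨l.get, List.ofFn_get l⟩
  · exact absurd (by simp [hg l h]) hl

/-! ### Gradients and Hessians in a Hilbert space -/

section Hessian

variable {E : Type*} [NormedAddCommGroup E] [InnerProductSpace ℝ E] [CompleteSpace E]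

theorem inner_gradient (g : E → ℝ) (z v : E) : ⟪gradient g z, v⟫ = fderiv ℝ g z v :=
  InnerProductSpace.toDual_symm_apply

theorem differentiable_gradient {g : E → ℝ} (hg : ContDiff ℝ 2 g) :
    Differentiable ℝ (gradient g) := fun z =>
  (InnerProductSpace.toDual ℝ E).symm.toContinuousLinearEquiv.differentiable.differentiableAt.comp z
    ((hg.fderiv_right (m := 1) (by norm_num)).differentiable (by norm_num) z)

theorem hasFDerivAt_gradient {g : E → ℝ} (hg : ContDiff ℝ 2 g) (z : E) :
    HasFDerivAt (gradient g) (hess g z) z :=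
  (differentiable_gradient hg z).hasFDerivAt

theorem inner_hess {g : E → ℝ} (hg : ContDiff ℝ 2 g) (z u v : E) :
    ⟪hess g z u, v⟫ = fderiv ℝ (fderiv ℝ g) z u v := by
  have h1 : HasFDerivAt (fun x => ⟪v, gradient g x⟫) ((innerSL ℝ v).comp (hess g z)) z :=
    (innerSL ℝ v).hasFDerivAt.comp z (hasFDerivAt_gradient hg z)
  have h2 : HasFDerivAt (fun x => fderiv ℝ g x v)
      ((ContinuousLinearMap.apply ℝ ℝ v).comp (fderiv ℝ (fderiv ℝ g) z)) z :=
    (ContinuousLinearMap.apply ℝ ℝ v).hasFDerivAt.comp z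
      ((hg.fderiv_right (m := 1) (by norm_num)).differentiable (by norm_num) z).hasFDerivAt
  have h3 : (fun x => fderiv ℝ g x v) = fun x => ⟪v, gradient g x⟫ := by
    funext x
    rw [real_inner_comm, inner_gradient]
  rw [h3] at h2
  have h4 := congrArg (fun A : E →L[ℝ] ℝ => A u) (h1.unique h2)
  simp only [ContinuousLinearMap.comp_apply, innerSL_apply_apply,
    ContinuousLinearMap.apply_apply] at h4
  rw [← h4, real_inner_comm]

theorem isSymmetric_hess {g : E → ℝ} (hg : ContDiff ℝ 2 g) (z : E) :
    (hess g z : E →ₗ[ℝ] E).IsSymmetric := fun u v => by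
  have h := (hg.contDiffAt (x := z)).isSymmSndFDerivAt (by simp)
  simp only [ContinuousLinearMap.coe_coe]
  rw [inner_hess hg, real_inner_comm, inner_hess hg]
  exact h u v

theorem continuous_hess {g : E → ℝ} (hg : ContDiff ℝ 2 g) : Continuous (hess g) := by
  have h1 : ContDiff ℝ 1 (gradient g) :=
    (InnerProductSpace.toDual ℝ E).symm.toContinuousLinearEquiv.contDiff.comp
      (hg.fderiv_right (m := 1) (by norm_num))
  exact h1.continuous_fderiv (by norm_num)

/-- The chain rule gives L* ∘ ∇²φ ∘ L, and ‖L*‖ = ‖L‖. -/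
theorem norm_hess_comp_le {G : Type*} [NormedAddCommGroup G] [InnerProductSpace ℝ G]
    [CompleteSpace G] {φ : G → ℝ} (hφ : ContDiff ℝ 2 φ) (L : E →L[ℝ] G) (z : E) :
    ‖hess (fun x => φ (L x)) z‖ ≤ ‖hess φ (L z)‖ * ‖L‖ ^ 2 := by
  have h1 : gradient (fun x => φ (L x)) =
      fun x => ContinuousLinearMap.adjoint L (gradient φ (L x)) := by
    funext x
    refine ext_inner_right ℝ fun v => ?_
    rw [inner_gradient, ContinuousLinearMap.adjoint_inner_left, inner_gradient]
    have h2 : HasFDerivAt (fun x => φ (L x)) ((fderiv ℝ φ (L x)).comp L) x :=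
      ((hφ.differentiable (by norm_num)) (L x)).hasFDerivAt.comp x L.hasFDerivAt
    rw [h2.fderiv]
    rfl
  have h2 : hess (fun x => φ (L x)) z =
      (ContinuousLinearMap.adjoint L).comp ((hess φ (L z)).comp L) := by
    unfold hess
    rw [h1]
    exact ((ContinuousLinearMap.adjoint L).hasFDerivAt.comp z
      ((hasFDerivAt_gradient hφ (L z)).comp z L.hasFDerivAt)).fderiv
  rw [h2]
  calc _ ≤ ‖ContinuousLinearMap.adjoint L‖ * (‖hess φ (L z)‖ * ‖L‖) :=
        (ContinuousLinearMap.opNorm_comp_le _ _).trans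
          (mul_le_mul_of_nonneg_left (ContinuousLinearMap.opNorm_comp_le _ _) (norm_nonneg _))
    _ = _ := by rw [LinearIsometryEquiv.norm_map]; ring

/-- The second-order Taylor bound for the gradient of a function with Lipschitz Hessian. -/
theorem norm_gradient_sub_le {g : E → ℝ} (hg : ContDiff ℝ 2 g) {ρ : ℝ}
    (hL : ∀ z z', ‖hess g z - hess g z'‖ ≤ ρ * ‖z - z'‖) (z d : E) :
    ‖gradient g (z + d) - gradient g z - hess g z d‖ ≤ ρ / 2 * ‖d‖ ^ 2 := by
  -- The remainder along the segment vanishes at t = 0, and its derivative has norm at most ρ‖d‖²t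
  -- for t in [0, 1]; comparison with the primitive of that bound gives the factor 1/2.
  have hd : ∀ t : ℝ, HasDerivAt (fun t : ℝ => gradient g (z + t • d) - gradient g z - t • hess g z d)
      ((hess g (z + t • d) - hess g z) d) t := fun t => by
    have h1 : HasDerivAt (fun t : ℝ => z + t • d) d t := by
      simpa using ((hasDerivAt_id t).smul_const d).const_add z
    have h2 := (hasFDerivAt_gradient hg (z + t • d)).comp_hasDerivAt t h1
    have h3 : HasDerivAt (fun t : ℝ => t • hess g z d) (hess g z d) t := by
      simpa using (hasDerivAt_id t).smul_const (hess g z d)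
    exact (h2.sub_const _).sub h3
  have hB : ∀ t : ℝ, HasDerivAt (fun t : ℝ => ρ / 2 * ‖d‖ ^ 2 * t ^ 2) (ρ * ‖d‖ ^ 2 * t) t :=
    fun t => by
      have := (hasDerivAt_pow 2 t).const_mul (ρ / 2 * ‖d‖ ^ 2)
      refine this.congr_deriv ?_
      simp only [Nat.cast_ofNat, Nat.add_one_sub_one, pow_one]
      ring
  have := image_norm_le_of_norm_deriv_right_le_deriv_boundary (a := 0) (b := 1)
    (fun t _ => (hd t).continuousAt.continuousWithinAt)
    (fun t _ => (hd t).hasDerivWithinAt) (B := fun t : ℝ => ρ / 2 * ‖d‖ ^ 2 * t ^ 2)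
    (by simp) hB (fun t ht => by
      refine (ContinuousLinearMap.le_opNorm _ _).trans ?_
      have h1 := hL (z + t • d) z
      rw [add_sub_cancel_left, norm_smul, Real.norm_of_nonneg ht.1] at h1
      nlinarith [mul_le_mul_of_nonneg_right h1 (norm_nonneg d)])
    (Set.right_mem_Icc.2 zero_le_one)
  simpa using this

theorem gradient_const_mul_sum {ι : Type*} [Fintype ι] {f : ι → E → ℝ}
    (hf : ∀ i, ContDiff ℝ 2 (f i)) (c : ℝ) (z : E) :
    gradient (fun z => c * ∑ i, f i z) z = c • ∑ i, gradient (f i) z := by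
  refine ext_inner_right ℝ fun v => ?_
  have h1 : HasFDerivAt (fun z => c * ∑ i, f i z) (c • ∑ i, fderiv ℝ (f i) z) z :=
    (HasFDerivAt.fun_sum fun i _ =>
      ((hf i).differentiable (by norm_num) z).hasFDerivAt).const_mul _
  rw [inner_gradient, h1.fderiv, real_inner_smul_left, sum_inner]
  simp

theorem hess_const_mul_sum {ι : Type*} [Fintype ι] {f : ι → E → ℝ}
    (hf : ∀ i, ContDiff ℝ 2 (f i)) (c : ℝ) (z : E) :
    hess (fun z => c * ∑ i, f i z) z = c • ∑ i, hess (f i) z := by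
  have h1 : gradient (fun z => c * ∑ i, f i z) = fun z => c • ∑ i, gradient (f i) z :=
    funext (gradient_const_mul_sum hf c)
  unfold hess
  rw [h1]
  exact ((HasFDerivAt.fun_sum fun i _ => hasFDerivAt_gradient (hf i) z).const_smul _).fderiv

end Hessian

/-! ### Failure probability of one subsampled Hessian -/

theorem contDiff_const_mul_sum {E : Type*} [NormedAddCommGroup E] [NormedSpace ℝ E] {ι : Type*}
    [Fintype ι] {f : ι → E → ℝ}
    (hf : ∀ i, ContDiff ℝ 2 (f i)) (c : ℝ) : ContDiff ℝ 2 fun z => c * ∑ i, f i z :=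
  contDiff_const.mul (ContDiff.sum fun i _ => hf i)

theorem contDiff_finiteSum {m n N : ℕ} {f : Fin N → PairSpace m n → ℝ}
    (hf : ∀ i, ContDiff ℝ 2 (f i)) : ContDiff ℝ 2 (finiteSum f) :=
  contDiff_const_mul_sum hf _

theorem hess_finiteSum {m n N : ℕ} {f : Fin N → PairSpace m n → ℝ}
    (hf : ∀ i, ContDiff ℝ 2 (f i)) (z : PairSpace m n) :
    hess (finiteSum f) z = (1 / (N : ℝ)) • ∑ i, hess (f i) z :=
  hess_const_mul_sum hf _ z

/-- The map `z ↦ (aᵀx, bᵀy)` as a continuous linear map. -/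
noncomputable def planeMap {m n : ℕ} (a : EuclideanSpace ℝ (Fin m)) (b : EuclideanSpace ℝ (Fin n)) :
    PairSpace m n →L[ℝ] WithLp 2 (ℝ × ℝ) :=
  LinearMap.mkContinuous
    { toFun := planePoint a b
      map_add' := fun x y => by
        simp only [planePoint, WithLp.add_fst, WithLp.add_snd, inner_add_right]; rfl
      map_smul' := fun c x => by
        simp only [planePoint, WithLp.smul_fst, WithLp.smul_snd, real_inner_smul_right]; rfl }
    (√(‖a‖ ^ 2 + ‖b‖ ^ 2)) fun z => by
      refine le_of_sq_le_sq ?_ (by positivity)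
      simp only [LinearMap.coe_mk, AddHom.coe_mk, planePoint]
      rw [mul_pow, Real.sq_sqrt (by positivity), WithLp.prod_norm_sq_eq_of_L2,
        WithLp.prod_norm_sq_eq_of_L2 z]
      change ‖⟪a, z.fst⟫‖ ^ 2 + ‖⟪b, z.snd⟫‖ ^ 2 ≤ _
      have h1 : ‖⟪a, z.fst⟫‖ ^ 2 ≤ ‖a‖ ^ 2 * ‖z.fst‖ ^ 2 := by
        rw [← mul_pow]; gcongr; exact norm_inner_le_norm _ _
      have h2 : ‖⟪b, z.snd⟫‖ ^ 2 ≤ ‖b‖ ^ 2 * ‖z.snd‖ ^ 2 := by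
        rw [← mul_pow]; gcongr; exact norm_inner_le_norm _ _
      nlinarith [mul_nonneg (sq_nonneg ‖a‖) (sq_nonneg ‖z.snd‖),
        mul_nonneg (sq_nonneg ‖b‖) (sq_nonneg ‖z.fst‖)]

theorem norm_planeMap_sq_le {m n : ℕ} (a : EuclideanSpace ℝ (Fin m))
    (b : EuclideanSpace ℝ (Fin n)) : ‖planeMap a b‖ ^ 2 ≤ ‖a‖ ^ 2 + ‖b‖ ^ 2 := by
  have h : ‖planeMap a b‖ ≤ √(‖a‖ ^ 2 + ‖b‖ ^ 2) :=
    LinearMap.mkContinuous_norm_le _ (Real.sqrt_nonneg _) _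
  calc _ ≤ √(‖a‖ ^ 2 + ‖b‖ ^ 2) ^ 2 := by gcongr
    _ = _ := Real.sq_sqrt (by positivity)

theorem importanceWeight_nonneg {m n : ℕ} (φ : WithLp 2 (ℝ × ℝ) → ℝ)
    (a : EuclideanSpace ℝ (Fin m)) (b : EuclideanSpace ℝ (Fin n)) (z : PairSpace m n) :
    0 ≤ importanceWeight φ a b z := by
  unfold importanceWeight; positivity

/-- The component is φ composed with `planeMap a b`, whose squared norm is at most ‖a‖² + ‖b‖². -/
theorem norm_hess_le_importanceWeight {m n : ℕ} {φ : WithLp 2 (ℝ × ℝ) → ℝ} (hφ : ContDiff ℝ 2 φ)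
    {a : EuclideanSpace ℝ (Fin m)} {b : EuclideanSpace ℝ (Fin n)} {g : PairSpace m n → ℝ}
    (hg : ∀ z, g z = φ (planePoint a b z)) (z : PairSpace m n) :
    ‖hess g z‖ ≤ importanceWeight φ a b z := by
  have h1 : g = fun z => φ (planeMap a b z) := funext hg
  rw [h1]
  exact (norm_hess_comp_le hφ (planeMap a b) z).trans
    (mul_le_mul_of_nonneg_left (norm_planeMap_sq_le a b) (norm_nonneg _))

/-- What the three sampling schemes have in common at a point `z`: the scaled Hessians are bounded,
and their mean is the Hessian of the objective. -/
theorem sum_smul_scaled_hess {m n N : ℕ} {f : Fin N → PairSpace m n → ℝ}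
    (hf : ∀ i, ContDiff ℝ 2 (f i)) {p : Fin N → ℝ} {z : PairSpace m n}
    (hp : ∀ i, p i = 0 → hess (f i) z = 0) :
    ∑ i, p i • ((1 / (N * p i)) • hess (f i) z) = hess (finiteSum f) z := by
  rw [hess_finiteSum hf, Finset.smul_sum]
  refine Finset.sum_congr rfl fun i _ => ?_
  by_cases h : p i = 0
  · simp [hp i h]
  · rw [smul_smul]
    congr 1
    field_simp

/-- The operators ∇²fᵢ/(N pᵢ) have p-mean ∇²f (`sum_smul_scaled_hess`). In terms of them, the
sampling error is a centred sum divided by s. -/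
theorem subsampledHessian_ofFn_sub {m n N s : ℕ} (hs : 0 < s) (f : Fin N → PairSpace m n → ℝ)
    (p : Fin N → ℝ) (z : PairSpace m n) (M : PairSpace m n →L[ℝ] PairSpace m n)
    (l : Fin s → Fin N) :
    subsampledHessian f p (List.ofFn l) z - M =
      (1 / (s : ℝ)) • centredSum (fun i => (1 / (N * p i)) • hess (f i) z) M l := by
  have hsR : (s : ℝ) ≠ 0 := by positivity
  have h1 : (1 / ((N : ℝ) * s)) = (1 / (s : ℝ)) * (1 / N) := by rw [one_div_mul_one_div, mul_comm]
  simp only [subsampledHessian, centredSum, List.length_ofFn, List.map_ofFn, List.sum_ofFn,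
    Function.comp_apply, Finset.sum_sub_distrib]
  rw [smul_sub, Finset.sum_const, Finset.card_univ, Fintype.card_fin, ← Nat.cast_smul_eq_nsmul ℝ,
    smul_smul (1 / (s : ℝ)) (s : ℝ), one_div_mul_cancel hsR, one_smul, h1, mul_smul,
    Finset.smul_sum (r := 1 / (N : ℝ))]
  simp only [smul_smul, one_div_mul_one_div]

theorem lt_norm_subsampledHessian_iff {m n N s : ℕ} (hs : 0 < s) (f : Fin N → PairSpace m n → ℝ)
    (p : Fin N → ℝ) (z : PairSpace m n) (M : PairSpace m n →L[ℝ] PairSpace m n)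
    (l : Fin s → Fin N) (τ : ℝ) :
    τ < ‖subsampledHessian f p (List.ofFn l) z - M‖ ↔
      s * τ < ‖centredSum (fun i => (1 / (N * p i)) • hess (f i) z) M l‖ := by
  have hsR : (0 : ℝ) < s := by exact_mod_cast hs
  rw [subsampledHessian_ofFn_sub hs, norm_smul, Real.norm_of_nonneg (by positivity),
    one_div, inv_mul_eq_div, lt_div_iff₀ hsR, mul_comm]

theorem isSymmetric_smul {E : Type*} [NormedAddCommGroup E] [InnerProductSpace ℝ E]
    {A : E →L[ℝ] E} (hA : (A : E →ₗ[ℝ] E).IsSymmetric) (c : ℝ) :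
    ((c • A : E →L[ℝ] E) : E →ₗ[ℝ] E).IsSymmetric := fun x y => by
  have := hA x y
  simp only [ContinuousLinearMap.coe_coe] at this
  simp [real_inner_smul_left, real_inner_smul_right, this]

theorem finrank_pairSpace (m n : ℕ) : Module.finrank ℝ (PairSpace m n) = m + n := by
  rw [LinearEquiv.finrank_eq (WithLp.linearEquiv 2 ℝ
    (EuclideanSpace ℝ (Fin m) × EuclideanSpace ℝ (Fin n)))]
  simp

open Classical in
/-- The failure probability of `s` independent draws. -/
theorem tsum_lawWithReplacement_le {m n N s : ℕ} {f : Fin N → PairSpace m n → ℝ}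
    (hf : ∀ i, ContDiff ℝ 2 (f i)) {p : Fin N → ℝ} {z : PairSpace m n} (hp : ∀ i, 0 ≤ p i)
    (hp1 : ∑ i, p i = 1) (hp0 : ∀ i, p i = 0 → hess (f i) z = 0) {W : ℝ} (hW0 : 0 ≤ W)
    (hW : ∀ i, ‖(1 / (N * p i)) • hess (f i) z‖ ≤ W) {τ δ : ℝ} (hτ : 0 < τ) (hδ : 0 < δ)
    (hs : 0 < s) (hsize : 4 * W ^ 2 / τ ^ 2 * Real.log (2 * ((m : ℝ) + n) / δ) ≤ s) :
    ∑' l, ENNReal.ofReal (if τ < ‖subsampledHessian f p l z - hess (finiteSum f) z‖ then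
      lawWithReplacement p s l else 0) ≤ ENNReal.ofReal δ := by
  have hnn : ∀ l : List (Fin N), 0 ≤ (l.map p).prod := fun l =>
    List.prod_nonneg fun x hx => by
      obtain ⟨i, _, rfl⟩ := List.mem_map.1 hx
      exact hp i
  rw [tsum_list_eq_sum_ofFn (s := s)]
  · refine ENNReal.ofReal_le_ofReal ?_
    have := sum_withReplacement_le (s := s) (fun i => isSymmetric_smul (isSymmetric_hess (hf i) z)
      (1 / (N * p i))) (isSymmetric_hess (contDiff_finiteSum hf) z) hW0 hW hp hp1
      (sum_smul_scaled_hess hf hp0) hτ hδ hs (by rw [finrank_pairSpace]; exact_mod_cast hsize)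
    refine le_trans (le_of_eq (Finset.sum_congr rfl fun l _ => ?_)) this
    simp only [lt_norm_subsampledHessian_iff hs, lawWithReplacement, List.length_ofFn, if_true,
      List.map_ofFn, List.prod_ofFn, Function.comp_apply]
  · intro l hl
    simp [lawWithReplacement, hl]
  · intro l
    unfold lawWithReplacement
    split_ifs
    exacts [hnn l, le_rfl, le_rfl]

open Classical in
/-- The failure probability of `s` uniform draws without replacement. -/
theorem tsum_lawWithoutReplacement_le {m n N s : ℕ} (hN : 0 < N) {f : Fin N → PairSpace m n → ℝ}
    (hf : ∀ i, ContDiff ℝ 2 (f i)) {z : PairSpace m n} {W : ℝ} (hW0 : 0 ≤ W)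
    (hW : ∀ i, ‖hess (f i) z‖ ≤ W) {τ δ : ℝ} (hτ : 0 < τ) (hδ : 0 < δ)
    (hs : 0 < s) (hsize : 4 * W ^ 2 / τ ^ 2 * Real.log (2 * ((m : ℝ) + n) / δ) ≤ s) :
    ∑' l, ENNReal.ofReal
      (if τ < ‖subsampledHessian f (fun _ => 1 / (N : ℝ)) l z - hess (finiteSum f) z‖ then
        lawWithoutReplacement N s l else 0) ≤ ENNReal.ofReal δ := by
  have hNR : (N : ℝ) ≠ 0 := by positivity
  rw [tsum_list_eq_sum_ofFn (s := s)]
  · refine ENNReal.ofReal_le_ofReal ?_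
    have := sum_withoutReplacement_le (s := s) hN (fun i => isSymmetric_smul
      (isSymmetric_hess (hf i) z) (1 / (N * (1 / (N : ℝ)))))
      (isSymmetric_hess (contDiff_finiteSum hf) z) hW0
      (fun i => by simpa [hNR] using hW i)
      (sum_smul_scaled_hess hf fun i h => absurd h (by positivity)) hτ hδ hs
      (by rw [finrank_pairSpace]; exact_mod_cast hsize)
    refine le_trans (le_of_eq (Finset.sum_congr rfl fun l _ => ?_)) this
    simp only [lt_norm_subsampledHessian_iff hs, lawWithoutReplacement, List.length_ofFn, true_and,
      List.nodup_ofFn]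
  · intro l hl
    simp [lawWithoutReplacement, hl]
  · intro l
    unfold lawWithoutReplacement
    positivity

theorem importanceProb_nonneg {m n N : ℕ} (φ : Fin N → WithLp 2 (ℝ × ℝ) → ℝ)
    (a : Fin N → EuclideanSpace ℝ (Fin m)) (b : Fin N → EuclideanSpace ℝ (Fin n))
    (z : PairSpace m n) (i : Fin N) : 0 ≤ importanceProb φ a b z i := by
  unfold importanceProb
  split_ifs
  · positivity
  · exact div_nonneg (importanceWeight_nonneg _ _ _ _)
      (Finset.sum_nonneg fun j _ => importanceWeight_nonneg _ _ _ _)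

theorem sum_importanceProb {m n N : ℕ} (hN : 0 < N) (φ : Fin N → WithLp 2 (ℝ × ℝ) → ℝ)
    (a : Fin N → EuclideanSpace ℝ (Fin m)) (b : Fin N → EuclideanSpace ℝ (Fin n))
    (z : PairSpace m n) : ∑ i, importanceProb φ a b z i = 1 := by
  unfold importanceProb
  split_ifs with h
  · have : (N : ℝ) ≠ 0 := by positivity
    simp [this]
  · rw [← Finset.sum_div, div_self h]

/-- Indices that are never drawn do not bias the estimate: their weight, and hence their Hessian, is
zero. -/
theorem hess_eq_zero_of_importanceProb {m n N : ℕ} (hN : 0 < N) {f : Fin N → PairSpace m n → ℝ}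
    {φ : Fin N → WithLp 2 (ℝ × ℝ) → ℝ}
    {a : Fin N → EuclideanSpace ℝ (Fin m)} {b : Fin N → EuclideanSpace ℝ (Fin n)}
    (hφ : ∀ i, ContDiff ℝ 2 (φ i)) (hf : ∀ i z, f i z = φ i (planePoint (a i) (b i) z))
    (z : PairSpace m n) (i : Fin N) (h : importanceProb φ a b z i = 0) : hess (f i) z = 0 := by
  have h1 := norm_hess_le_importanceWeight (hφ i) (hf i) z
  unfold importanceProb at h
  split_ifs at h with h0
  · exact absurd h (by positivity)
  · rcases div_eq_zero_iff.1 h with h | h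
    · rw [h] at h1
      exact norm_le_zero_iff.1 h1
    · exact absurd h h0

/-- The probability is proportional to a bound for the Hessian, so the division by pᵢ cancels wᵢ and
leaves the average of all weights. This is why B_avg replaces B_max in the sample size. -/
theorem norm_scaled_hess_importance_le {m n N : ℕ} {f : Fin N → PairSpace m n → ℝ}
    {φ : Fin N → WithLp 2 (ℝ × ℝ) → ℝ}
    {a : Fin N → EuclideanSpace ℝ (Fin m)} {b : Fin N → EuclideanSpace ℝ (Fin n)}
    (hφ : ∀ i, ContDiff ℝ 2 (φ i)) (hf : ∀ i z, f i z = φ i (planePoint (a i) (b i) z))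
    {B : Fin N → ℝ} (hB : ∀ i z, importanceWeight (φ i) (a i) (b i) z ≤ B i)
    (z : PairSpace m n) (i : Fin N) :
    ‖(1 / (N * importanceProb φ a b z i)) • hess (f i) z‖ ≤ (1 / (N : ℝ)) * ∑ i, B i := by
  have hw := norm_hess_le_importanceWeight (hφ i) (hf i) z
  have hnn : ∀ j, 0 ≤ importanceWeight (φ j) (a j) (b j) z :=
    fun j => importanceWeight_nonneg _ _ _ _
  have hsum : ∑ j, importanceWeight (φ j) (a j) (b j) z ≤ ∑ j, B j :=
    Finset.sum_le_sum fun j _ => hB j z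
  have hsum0 : 0 ≤ ∑ j, importanceWeight (φ j) (a j) (b j) z := Finset.sum_nonneg fun j _ => hnn j
  have hR : 0 ≤ (1 / (N : ℝ)) * ∑ i, B i := mul_nonneg (by positivity) (hsum0.trans hsum)
  by_cases hwi : importanceWeight (φ i) (a i) (b i) z = 0
  · rw [hwi] at hw
    rw [norm_le_zero_iff.1 hw]
    simpa using hR
  · have hpos : 0 < importanceWeight (φ i) (a i) (b i) z := lt_of_le_of_ne (hnn i) (Ne.symm hwi)
    have hs : ∑ j, importanceWeight (φ j) (a j) (b j) z ≠ 0 :=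
      (hpos.trans_le (Finset.single_le_sum
        (f := fun j => importanceWeight (φ j) (a j) (b j) z) (fun j _ => hnn j)
        (Finset.mem_univ i))).ne'
    have hp := importanceProb_nonneg φ a b z i
    rw [norm_smul, Real.norm_of_nonneg (by positivity)]
    calc _ ≤ (1 / (N * importanceProb φ a b z i)) * importanceWeight (φ i) (a i) (b i) z := by
          gcongr
      _ = (1 / (N : ℝ)) * ∑ j, importanceWeight (φ j) (a j) (b j) z := by
          rw [importanceProb, if_neg hs]
          have : (N : ℝ) ≠ 0 := by have := i.pos; positivity
          field_simp
      _ ≤ _ := by gcongr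

/-- The failure probability of each sampling scheme. -/
theorem IsSamplingSchemeFor.tsum_law_le {m n N : ℕ} (hN : 0 < N) {f : Fin N → PairSpace m n → ℝ}
    (hf : ∀ i, ContDiff ℝ 2 (f i)) {S : SamplingScheme m n N} (hS : IsSamplingSchemeFor f S)
    {s : ℕ} (hs : 0 < s) {τ δ : ℝ} (hτ : 0 < τ) (hδ : 0 < δ) (hδ1 : δ ≤ 1)
    (hsize : S.minSize τ δ ≤ s) (z : PairSpace m n) :
    ∑' l, ENNReal.ofReal
      ({l | τ < ‖subsampledHessian f (S.prob z) l z - hess (finiteSum f) z‖}.indicator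
        (S.law z s) l) ≤ ENNReal.ofReal δ := by
  classical
  simp only [Set.indicator_apply, Set.mem_ofPred_eq]
  have hNR : (0 : ℝ) < N := by exact_mod_cast hN
  -- For m + n = 0 all operators vanish. Otherwise the logarithm is nonnegative, which is needed to
  -- weaken the constant 16 of the uniform schemes to the constant 4 that suffices.
  by_cases hmn : 0 < m + n
  swap
  · have hsub : Subsingleton (PairSpace m n) := by
      rw [← Module.finrank_zero_iff (R := ℝ), finrank_pairSpace]; omega
    have h0 : ∀ A : PairSpace m n →L[ℝ] PairSpace m n, ‖A‖ = 0 := fun A => by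
      rw [norm_eq_zero]
      ext1 x
      exact Subsingleton.elim _ _
    simp [h0, not_lt.2 hτ.le]
  have hd : (1 : ℝ) ≤ (m : ℝ) + n := by exact_mod_cast hmn
  have hlog : 0 ≤ Real.log (2 * ((m : ℝ) + n) / δ) :=
    Real.log_nonneg (by rw [le_div_iff₀ hδ]; linarith)
  have huni : ∀ B : Fin N → ℝ, (∀ i z, ‖hess (f i) z‖ ≤ B i) →
      (∀ i, ‖hess (f i) z‖ ≤ ⨆ i, B i) ∧ 0 ≤ ⨆ i, B i := fun B hB => by
    have h1 : ∀ i, ‖hess (f i) z‖ ≤ ⨆ i, B i := fun i =>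
      (hB i z).trans (le_ciSup (Set.finite_range B).bddAbove i)
    exact ⟨h1, (norm_nonneg _).trans (h1 ⟨0, hN⟩)⟩
  have hle : ∀ B L : ℝ, 0 ≤ L → 16 * B ^ 2 / τ ^ 2 * L ≤ s → 4 * B ^ 2 / τ ^ 2 * L ≤ s :=
    fun B L hL h => by
      refine le_trans ?_ h
      gcongr
      norm_num
  cases hS with
  | uniform_with B hB =>
    obtain ⟨h1, h2⟩ := huni B hB
    refine tsum_lawWithReplacement_le (p := fun _ => 1 / (N : ℝ)) hf (fun i => by positivity) (by simp [hNR.ne'])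
      (fun i h => absurd h (by positivity)) h2 (fun i => ?_) hτ hδ hs (hle _ _ hlog hsize)
    simpa [hNR.ne'] using h1 i
  | uniform_without B hB =>
    obtain ⟨h1, h2⟩ := huni B hB
    exact tsum_lawWithoutReplacement_le hN hf h2 h1 hτ hδ hs (hle _ _ hlog hsize)
  | nonuniform φ a b B hφ hfφ hB =>
    exact tsum_lawWithReplacement_le hf (importanceProb_nonneg φ a b z)
      (sum_importanceProb hN φ a b z) (hess_eq_zero_of_importanceProb hN hφ hfφ z)
      ((norm_nonneg _).trans (norm_scaled_hess_importance_le hφ hfφ hB z ⟨0, hN⟩))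
      (norm_scaled_hess_importance_le hφ hfφ hB z) hτ hδ hs hsize

/-! ### The extragradient inequality, sums of reciprocals, the gradient of the cubic model -/

section Abstract

variable {E : Type*} [NormedAddCommGroup E] [InnerProductSpace ℝ E]

/-- One extragradient step with a direction that is close to that of the cubic regularization. -/
theorem extragradient_step {ρ lam : ℝ} (hρ : 0 < ρ) (hlam : 0 < lam) {zhat d F c : E}
    (hF : ‖F + (6 * ρ) • c‖ ≤ ρ * ‖d‖ ^ 2) (hc : ‖c‖ ≤ ‖d‖ ^ 2)
    (hcd : 7 / 10 * ‖d‖ ^ 3 ≤ ⟪c, d⟫) (h1 : 1 / 15 ≤ lam * ρ * ‖d‖) (h2 : lam * ρ * ‖d‖ ≤ 1 / 14)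
    (w : E) :
    lam * ⟪F, zhat + d - w⟫ ≤
      1 / 2 * ‖zhat - w‖ ^ 2 - 1 / 2 * ‖zhat - lam • F - w‖ ^ 2 - 1 / 12 * ‖d‖ ^ 2 := by
  -- The constant is 1 - 6 · 7/10 = -16/5; in the next bound, 7 = 1 + 6.
  have hinner : ⟪F, d⟫ ≤ -(16 / 5) * ρ * ‖d‖ ^ 3 := by
    have e1 : ⟪F, d⟫ = ⟪F + (6 * ρ) • c, d⟫ - 6 * ρ * ⟪c, d⟫ := by
      rw [inner_add_left, real_inner_smul_left]; ring
    have e2 := real_inner_le_norm (F + (6 * ρ) • c) d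
    have e3 := mul_le_mul_of_nonneg_right hF (norm_nonneg d)
    have e4 := mul_le_mul_of_nonneg_left hcd (by positivity : 0 ≤ 6 * ρ)
    rw [e1]
    nlinarith
  have hnorm : ‖F‖ ≤ 7 * ρ * ‖d‖ ^ 2 := by
    have e1 : ‖F‖ ≤ ‖F + (6 * ρ) • c‖ + ‖(6 * ρ) • c‖ := by
      simpa using norm_sub_le (F + (6 * ρ) • c) ((6 * ρ) • c)
    rw [norm_smul, Real.norm_of_nonneg (by positivity : 0 ≤ 6 * ρ)] at e1
    nlinarith [mul_le_mul_of_nonneg_left hc (by positivity : 0 ≤ 6 * ρ)]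
  have hsq : ‖zhat - lam • F - w‖ ^ 2 =
      ‖zhat - w‖ ^ 2 - 2 * (lam * ⟪F, zhat - w⟫) + lam ^ 2 * ‖F‖ ^ 2 := by
    have : zhat - lam • F - w = (zhat - w) - lam • F := by abel
    rw [this, norm_sub_sq_real, real_inner_smul_right, norm_smul, mul_pow, Real.norm_eq_abs, sq_abs,
      real_inner_comm]
  have hsplit : ⟪F, zhat + d - w⟫ = ⟪F, zhat - w⟫ + ⟪F, d⟫ := by
    rw [← inner_add_right]; congr 1; abel
  set a := lam * ρ * ‖d‖ with ha
  have k1 : lam * ⟪F, d⟫ ≤ -(16 / 5) * a * ‖d‖ ^ 2 := by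
    have := mul_le_mul_of_nonneg_left hinner hlam.le
    rw [ha]; nlinarith
  have k2 : lam ^ 2 * ‖F‖ ^ 2 ≤ 49 * a ^ 2 * ‖d‖ ^ 2 := by
    have : ‖F‖ ^ 2 ≤ (7 * ρ * ‖d‖ ^ 2) ^ 2 := by gcongr
    have := mul_le_mul_of_nonneg_left this (sq_nonneg lam)
    rw [ha]; nlinarith
  -- The quadratic in a is convex and lies below -1/12 at both ends of [1/15, 1/14].
  have k3 : -(16 / 5) * a + 49 / 2 * a ^ 2 ≤ -(1 / 12) := by nlinarith
  have k4 := mul_le_mul_of_nonneg_right k3 (sq_nonneg ‖d‖)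
  rw [hsq, hsplit]
  nlinarith

/-- A lower bound for the sum of reciprocals in terms of the sum of squares. -/
theorem sum_one_div_ge {T : ℕ} (hT : 0 < T) {x : ℕ → ℝ} {D : ℝ} (hD : 0 < D)
    (hx : ∀ k < T, 0 < x k) (hsum : ∑ k ∈ Finset.range T, x k ^ 2 ≤ 6 * D ^ 2) :
    T * √T / (3 * D) ≤ ∑ k ∈ Finset.range T, 1 / x k := by
  have hTR : (0 : ℝ) < T := by exact_mod_cast hT
  have hr : 0 < √(T : ℝ) := Real.sqrt_pos.2 hTR
  have hr2 : √(T : ℝ) ^ 2 = T := Real.sq_sqrt hTR.le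
  set r := √(T : ℝ) with hrdef
  have hs : 0 < 3 * D / r := by positivity
  -- With 6D² relaxed to 9D² = Ts², s bounds the root mean square of the x k, and the claimed bound
  -- is T/s.
  set s := 3 * D / r with hsdef
  -- The tangent to the convex function u ↦ u^(-1/2) at u = s², evaluated at u = (x k)².
  have key : ∀ k ∈ Finset.range T, 3 / (2 * s) - x k ^ 2 / (2 * s ^ 3) ≤ 1 / x k := fun k hk => by
    have hxk := hx k (Finset.mem_range.1 hk)
    rw [div_sub_div _ _ (by positivity) (by positivity), div_le_div_iff₀ (by positivity) hxk]
    nlinarith [mul_nonneg hs.le (mul_nonneg (sq_nonneg (x k - s))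
      (by positivity : 0 ≤ x k + 2 * s))]
  have h1 := Finset.sum_le_sum key
  rw [Finset.sum_sub_distrib, Finset.sum_const, Finset.card_range, nsmul_eq_mul,
    ← Finset.sum_div] at h1
  refine le_trans ?_ h1
  have h2 : (∑ k ∈ Finset.range T, x k ^ 2) / (2 * s ^ 3) ≤ 9 * D ^ 2 / (2 * s ^ 3) := by
    gcongr
    nlinarith
  have h3 : 9 * D ^ 2 / (2 * s ^ 3) = T / (2 * s) := by
    rw [← hr2, hsdef]; field_simp
    norm_num
  have h4 : T * r / (3 * D) = T * (3 / (2 * s)) - T / (2 * s) := by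
    rw [hsdef]; field_simp; norm_num
  linarith

theorem norm_rpow_three_hasFDerivAt {X : Type*} [NormedAddCommGroup X] [InnerProductSpace ℝ X]
    (p : E →L[ℝ] X) (d : E) :
    HasFDerivAt (fun d => ‖p d‖ ^ 3) ((3 * ‖p d‖) • (innerSL ℝ (p d)).comp p) d := by
  have h1 := (hasFDerivAt_norm_rpow (p d) (p := 3) (by norm_num)).comp d p.hasFDerivAt
  have h2 : (fun d => ‖p d‖ ^ 3) = (fun x : X => ‖x‖ ^ (3 : ℝ)) ∘ p := by
    funext x
    exact_mod_cast (Real.rpow_natCast ‖p x‖ 3).symm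
  rw [h2]
  refine h1.congr_fderiv ?_
  have h3 : (3 : ℝ) - 2 = 1 := by norm_num
  rw [h3, Real.rpow_one]
  rfl

/-- The two block projections enter only as continuous linear maps p and q. Symmetry of H merges the
two halves of the derivative of the quadratic term. -/
theorem gradient_cubic {X Y : Type*} [NormedAddCommGroup X] [InnerProductSpace ℝ X]
    [NormedAddCommGroup Y] [InnerProductSpace ℝ Y] [CompleteSpace E] (p : E →L[ℝ] X)
    (q : E →L[ℝ] Y) (ρ : ℝ) (g : E) {H : E →L[ℝ] E} (hH : (H : E →ₗ[ℝ] E).IsSymmetric) (d v : E) :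
    ⟪gradient (fun d => ⟪d, g⟫ + (1 / 2) * ⟪d, H d⟫ + 2 * ρ * ‖p d‖ ^ 3 - 2 * ρ * ‖q d‖ ^ 3) d, v⟫ =
      ⟪g, v⟫ + ⟪H d, v⟫ + 6 * ρ * (‖p d‖ * ⟪p d, p v⟫ - ‖q d‖ * ⟪q d, q v⟫) := by
  have h1 : HasFDerivAt (fun d : E => ⟪d, g⟫) (innerSL ℝ g) d := by
    have : (fun d : E => ⟪d, g⟫) = innerSL ℝ g := by
      funext x; rw [innerSL_apply_apply, real_inner_comm]
    rw [this]
    exact (innerSL ℝ g).hasFDerivAt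
  have h2 : HasFDerivAt (fun d : E => ⟪d, H d⟫) _ d := (hasFDerivAt_id d).inner ℝ H.hasFDerivAt
  have h3 := ((h1.add (h2.const_mul (1 / 2))).add
    ((norm_rpow_three_hasFDerivAt p d).const_mul (2 * ρ))).sub
    ((norm_rpow_three_hasFDerivAt q d).const_mul (2 * ρ))
  have h4 : ⟪d, H v⟫ = ⟪H d, v⟫ := (hH d v).symm
  rw [inner_gradient]
  refine (congrArg (fun A : E →L[ℝ] ℝ => A v) h3.fderiv).trans ?_
  simp [h4, real_inner_comm (H d) v]
  ring

end Abstract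

/-! ### One Newton step on the product space -/

section Pair

variable {m n : ℕ}

/-- The reflection `(x, y) ↦ (x, -y)`. -/
noncomputable def reflect (z : PairSpace m n) : PairSpace m n := mkPair z.fst (-z.snd)

theorem norm_reflect (z : PairSpace m n) : ‖reflect z‖ = ‖z‖ := by
  rw [← sq_eq_sq₀ (norm_nonneg _) (norm_nonneg _), WithLp.prod_norm_sq_eq_of_L2,
    WithLp.prod_norm_sq_eq_of_L2]
  simp [reflect]

/-- The vector `(‖x‖ x, ‖y‖ y)`. -/
noncomputable def cubicVector (d : PairSpace m n) : PairSpace m n := mkPair (‖d.fst‖ • d.fst) (‖d.snd‖ • d.snd)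

theorem pair_inner (z w : PairSpace m n) : ⟪z, w⟫ = ⟪z.fst, w.fst⟫ + ⟪z.snd, w.snd⟫ :=
  WithLp.prod_inner_apply z w

theorem norm_cubicVector_le (d : PairSpace m n) : ‖cubicVector d‖ ≤ ‖d‖ ^ 2 := by
  refine le_of_sq_le_sq ?_ (by positivity)
  have h1 : ‖cubicVector d‖ ^ 2 = (‖d.fst‖ ^ 2) ^ 2 + (‖d.snd‖ ^ 2) ^ 2 := by
    rw [WithLp.prod_norm_sq_eq_of_L2]
    simp only [cubicVector, mkPair, WithLp.toLp_fst, WithLp.toLp_snd, norm_smul, norm_norm]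
    ring
  rw [h1, WithLp.prod_norm_sq_eq_of_L2]
  nlinarith [mul_nonneg (sq_nonneg ‖d.fst‖) (sq_nonneg ‖d.snd‖)]

theorem inner_cubicVector (d v : PairSpace m n) :
    ⟪cubicVector d, v⟫ = ‖d.fst‖ * ⟪d.fst, v.fst⟫ + ‖d.snd‖ * ⟪d.snd, v.snd⟫ := by
  rw [pair_inner]
  simp only [cubicVector, mkPair, WithLp.toLp_fst, WithLp.toLp_snd, real_inner_smul_left]

/-- With block norms p and q this is the power mean inequality p³ + q³ ≥ (p² + q²)^{3/2}/√2, where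
7/10 < 1/√2. After squaring, the product in `h2` equals 2(p³ + q³)² - (p² + q²)³. -/
theorem cube_le_inner_cubicVector (d : PairSpace m n) :
    7 / 10 * ‖d‖ ^ 3 ≤ ⟪cubicVector d, d⟫ := by
  rw [inner_cubicVector, real_inner_self_eq_norm_sq, real_inner_self_eq_norm_sq]
  have hr := WithLp.prod_norm_sq_eq_of_L2 d
  have hp := norm_nonneg d.fst
  have hq := norm_nonneg d.snd
  set p := ‖d.fst‖
  set q := ‖d.snd‖
  refine le_of_sq_le_sq ?_ (by positivity)
  have h1 : (7 / 10 * ‖d‖ ^ 3) ^ 2 = 49 / 100 * (p ^ 2 + q ^ 2) ^ 3 := by rw [← hr]; ring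
  have h2 : 0 ≤ (p - q) ^ 2 * (p ^ 4 + 2 * p ^ 3 * q + 2 * p * q ^ 3 + q ^ 4) := by positivity
  have h3 : 0 ≤ (p ^ 2 + q ^ 2) ^ 3 := by positivity
  rw [h1]
  nlinarith

theorem gradient_cubicModel (ρ : ℝ) (g : PairSpace m n) {H : PairSpace m n →L[ℝ] PairSpace m n}
    (hH : (H : PairSpace m n →ₗ[ℝ] PairSpace m n).IsSymmetric) (d : PairSpace m n) :
    gradient (cubicModel ρ g H) d = g + H d + (6 * ρ) • reflect (cubicVector d) := by
  refine ext_inner_right ℝ fun v => ?_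
  have h1 := gradient_cubic (WithLp.fstL 2 ℝ (EuclideanSpace ℝ (Fin m)) (EuclideanSpace ℝ (Fin n)))
    (WithLp.sndL 2 ℝ (EuclideanSpace ℝ (Fin m)) (EuclideanSpace ℝ (Fin n))) ρ g hH d v
  refine h1.trans ?_
  rw [inner_add_left, inner_add_left, real_inner_smul_left, pair_inner (reflect _)]
  simp only [reflect, cubicVector, mkPair, WithLp.toLp_fst, WithLp.toLp_snd, inner_neg_left,
    real_inner_smul_left]
  rfl

theorem saddleOperator_eq (f : PairSpace m n → ℝ) (z : PairSpace m n) :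
    saddleOperator f z = reflect (gradient f z) := rfl

/-- The reflection is an isometric involution. It carries F back to ∇f and puts the sign of the
cubic model on the regularising term. -/
theorem norm_reflect_add (u v : PairSpace m n) : ‖reflect u + v‖ = ‖u + reflect v‖ := by
  rw [← norm_reflect (u + reflect v)]
  congr 1
  apply WithLp.ofLp_injective
  refine Prod.ext ?_ ?_ <;> simp [reflect, add_comm]

theorem reflect_smul (c : ℝ) (u : PairSpace m n) : reflect (c • u) = c • reflect u := by
  apply WithLp.ofLp_injective
  simp [reflect]

/-- The accuracy `τ` is at most a quarter of `ρ‖Δ‖`. -/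
theorem accuracy_le {ρ κ τ₀ τ B : ℝ} (hρ : 0 < ρ) (hκ : 0 < κ) (hκ1 : κ < min 1 (ρ / 4))
    (hτ₀ : τ₀ < ρ / 4) (hB : 0 ≤ B) {g d : PairSpace m n}
    {H : PairSpace m n →L[ℝ] PairSpace m n}
    (hH : (H : PairSpace m n →ₗ[ℝ] PairSpace m n).IsSymmetric) (hHB : ‖H‖ ≤ B)
    (hτ : τ ≤ min τ₀ (ρ * (1 - κ) / (4 * (B + 6 * ρ)) * ‖g‖))
    (hstep : ‖gradient (cubicModel ρ g H) d‖ ≤ κ * min (‖d‖ ^ 2) ‖g‖) :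
    τ ≤ ρ / 4 * ‖d‖ := by
  have hκ' : κ < 1 := hκ1.trans_le (min_le_left _ _)
  -- For long steps the cap τ₀ < ρ/4 suffices. For short steps ‖d‖² ≤ ‖d‖, and the small model
  -- gradient gives (1 - κ)‖g‖ ≤ (B + 6ρ)‖d‖, which matches the second cap.
  rcases le_total 1 ‖d‖ with hd | hd
  · have := hτ.trans (min_le_left _ _)
    nlinarith
  · rw [gradient_cubicModel ρ g hH] at hstep
    have h1 : ‖g‖ ≤ κ * ‖g‖ + B * ‖d‖ + 6 * ρ * ‖d‖ ^ 2 := by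
      have e1 : g = (g + H d + (6 * ρ) • reflect (cubicVector d)) - H d -
        (6 * ρ) • reflect (cubicVector d) := by abel
      have e2 : ‖g‖ ≤ ‖g + H d + (6 * ρ) • reflect (cubicVector d)‖ + ‖H d‖ +
          ‖(6 * ρ) • reflect (cubicVector d)‖ := by
        conv_lhs => rw [e1]
        exact (norm_sub_le _ _).trans (add_le_add_left (norm_sub_le _ _) _)
      have e3 : ‖H d‖ ≤ B * ‖d‖ := H.le_of_opNorm_le hHB d
      have e4 : ‖(6 * ρ) • reflect (cubicVector d)‖ ≤ 6 * ρ * ‖d‖ ^ 2 := by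
        rw [norm_smul, norm_reflect, Real.norm_of_nonneg (by positivity)]
        exact mul_le_mul_of_nonneg_left (norm_cubicVector_le d) (by positivity)
      have e5 : κ * min (‖d‖ ^ 2) ‖g‖ ≤ κ * ‖g‖ :=
        mul_le_mul_of_nonneg_left (min_le_right _ _) hκ.le
      linarith
    have h2 : (1 - κ) * ‖g‖ ≤ (B + 6 * ρ) * ‖d‖ := by
      have : ‖d‖ ^ 2 ≤ ‖d‖ := by nlinarith [norm_nonneg d]
      nlinarith [mul_le_mul_of_nonneg_left this (by positivity : 0 ≤ 6 * ρ)]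
    refine (hτ.trans (min_le_right _ _)).trans ?_
    rw [div_mul_eq_mul_div, div_le_iff₀ (by positivity)]
    nlinarith [mul_le_mul_of_nonneg_left h2 hρ.le]

/-- One iteration of the method with an accurate Hessian. -/
theorem newton_step {f : PairSpace m n → ℝ} (hf : ContDiff ℝ 2 f) {ρ κ τ₀ τ B lam : ℝ}
    (hL : IsHessianLipschitz ρ f) (hρ : 0 < ρ) (hκ : 0 < κ) (hκ1 : κ < min 1 (ρ / 4))
    (hτ₀ : τ₀ < ρ / 4) (hB : 0 ≤ B) {zhat d : PairSpace m n}
    {H : PairSpace m n →L[ℝ] PairSpace m n}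
    (hH : (H : PairSpace m n →ₗ[ℝ] PairSpace m n).IsSymmetric) (hHB : ‖H‖ ≤ B)
    (hacc : ‖H - hess f zhat‖ ≤ τ)
    (hτ : τ ≤ min τ₀ (ρ * (1 - κ) / (4 * (B + 6 * ρ)) * ‖gradient f zhat‖))
    (hstep : ‖gradient (cubicModel ρ (gradient f zhat) H) d‖ ≤
      κ * min (‖d‖ ^ 2) ‖gradient f zhat‖)
    (hlam : 0 < lam) (h1 : 1 / 15 ≤ lam * ρ * ‖d‖) (h2 : lam * ρ * ‖d‖ ≤ 1 / 14)
    (w : PairSpace m n) :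
    lam * ⟪saddleOperator f (zhat + d), zhat + d - w⟫ ≤ 1 / 2 * ‖zhat - w‖ ^ 2 -
      1 / 2 * ‖zhat - lam • saddleOperator f (zhat + d) - w‖ ^ 2 - 1 / 12 * ‖d‖ ^ 2 := by
  refine extragradient_step hρ hlam (c := cubicVector d) ?_ (norm_cubicVector_le d)
    (cube_le_inner_cubicVector d) h1 h2 w
  have hτd := accuracy_le hρ hκ hκ1 hτ₀ hB hH hHB hτ hstep
  have hκ' : κ < ρ / 4 := hκ1.trans_le (min_le_right _ _)
  rw [saddleOperator_eq, norm_reflect_add, reflect_smul]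
  rw [gradient_cubicModel ρ _ hH] at hstep
  -- Taylor remainder, model residual and Hessian error, bounded by ρ/2, ρ/4 and ρ/4 times ‖d‖²;
  -- together they give the hypothesis of `extragradient_step`.
  have e1 : gradient f (zhat + d) + (6 * ρ) • reflect (cubicVector d) =
      (gradient f (zhat + d) - gradient f zhat - hess f zhat d) +
      (gradient f zhat + H d + (6 * ρ) • reflect (cubicVector d)) - (H - hess f zhat) d := by
    rw [sub_apply]; abel
  rw [e1]
  have e2 := norm_gradient_sub_le hf hL zhat d
  have e3 : ‖(H - hess f zhat) d‖ ≤ ρ / 4 * ‖d‖ * ‖d‖ :=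
    ContinuousLinearMap.le_of_opNorm_le _ (hacc.trans hτd) d
  have e4 : κ * min (‖d‖ ^ 2) ‖gradient f zhat‖ ≤ ρ / 4 * ‖d‖ ^ 2 := by
    have := min_le_left (‖d‖ ^ 2) ‖gradient f zhat‖
    nlinarith [mul_le_mul_of_nonneg_left this hκ.le, sq_nonneg ‖d‖]
  have e5 := norm_sub_le ((gradient f (zhat + d) - gradient f zhat - hess f zhat d) +
      (gradient f zhat + H d + (6 * ρ) • reflect (cubicVector d))) ((H - hess f zhat) d)
  have e6 := norm_add_le (gradient f (zhat + d) - gradient f zhat - hess f zhat d)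
      (gradient f zhat + H d + (6 * ρ) • reflect (cubicVector d))
  nlinarith

end Pair

/-! ### Gap estimates and the deterministic rate along one path -/

theorem convexOn_add_fderiv_le {E : Type*} [NormedAddCommGroup E] [NormedSpace ℝ E] {g : E → ℝ}
    (hc : ConvexOn ℝ Set.univ g) {x x' : E} {g' : E →L[ℝ] ℝ} (hg : HasFDerivAt g g' x) :
    g x + g' (x' - x) ≤ g x' := by
  have h1 : HasDerivAt (AffineMap.lineMap x x' : ℝ → E) (x' - x) 0 := AffineMap.hasDerivAt_lineMap
  have h2 : HasDerivAt (g ∘ (AffineMap.lineMap x x' : ℝ → E)) (g' (x' - x)) 0 :=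
    HasFDerivAt.comp_hasDerivAt (0 : ℝ) (by simpa using hg) h1
  have h3 : ConvexOn ℝ Set.univ (g ∘ (AffineMap.lineMap x x' : ℝ → E)) := by
    simpa using hc.comp_affineMap (AffineMap.lineMap x x' : ℝ →ᵃ[ℝ] E)
  have := h3.le_slope_of_hasDerivAt (Set.mem_univ 0) (Set.mem_univ 1) zero_lt_one h2
  simp only [slope_def_field, Function.comp_apply, AffineMap.lineMap_apply_zero,
    AffineMap.lineMap_apply_one, sub_zero, div_one] at this
  linarith

section Pair

variable {m n : ℕ} {f : PairSpace m n → ℝ}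

/-- The duality gap is bounded by the linearization with the saddle operator. -/
theorem gap_le_inner (hf : Differentiable ℝ f) (hcc : IsConvexConcave f)
    (z w : PairSpace m n) :
    f (mkPair z.fst w.snd) - f (mkPair w.fst z.snd) ≤ ⟪saddleOperator f z, z - w⟫ := by
  set iL : EuclideanSpace ℝ (Fin m) →L[ℝ] PairSpace m n :=
    ((WithLp.prodContinuousLinearEquiv 2 ℝ (EuclideanSpace ℝ (Fin m))
      (EuclideanSpace ℝ (Fin n))).symm.toContinuousLinearMap).comp (ContinuousLinearMap.inl ℝ _ _)
  set iR : EuclideanSpace ℝ (Fin n) →L[ℝ] PairSpace m n :=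
    ((WithLp.prodContinuousLinearEquiv 2 ℝ (EuclideanSpace ℝ (Fin m))
      (EuclideanSpace ℝ (Fin n))).symm.toContinuousLinearMap).comp (ContinuousLinearMap.inr ℝ _ _)
  have hL : ∀ x, iL x = mkPair x 0 := fun x => rfl
  have hR : ∀ y, iR y = mkPair 0 y := fun y => rfl
  have hdx : HasFDerivAt (fun x => mkPair x z.snd) iL z.fst := by
    have : (fun x => mkPair x z.snd) = fun x => iL x + mkPair 0 z.snd := by
      funext x
      apply WithLp.ofLp_injective
      refine Prod.ext ?_ ?_ <;> simp [hL]
    rw [this]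
    exact iL.hasFDerivAt.add_const _
  have hdy : HasFDerivAt (fun y => mkPair z.fst y) iR z.snd := by
    have : (fun y => mkPair z.fst y) = fun y => iR y + mkPair z.fst 0 := by
      funext x
      apply WithLp.ofLp_injective
      refine Prod.ext ?_ ?_ <;> simp [hR]
    rw [this]
    exact iR.hasFDerivAt.add_const _
  have hz : HasFDerivAt f (fderiv ℝ f z) z := (hf z).hasFDerivAt
  -- Tangent inequalities at z in each block, for f(·, y) and -f(x, ·); on adding them the value f z
  -- cancels.
  have h1 := convexOn_add_fderiv_le (hcc.1 z.snd) (x' := w.fst)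
    (HasFDerivAt.comp z.fst (f := fun x => mkPair x z.snd) hz hdx)
  have h2 := convexOn_add_fderiv_le (hcc.2 z.fst).neg (x' := w.snd)
    (HasFDerivAt.comp z.snd (f := fun y => mkPair z.fst y) hz hdy).neg
  simp only [ContinuousLinearMap.comp_apply, Pi.neg_apply, neg_apply, ← inner_gradient] at h1 h2
  rw [pair_inner] at h1 h2 ⊢
  simp only [hL, hR, mkPair, WithLp.toLp_fst, WithLp.toLp_snd, inner_zero_right, add_zero,
    zero_add, saddleOperator, inner_neg_left, WithLp.sub_fst, WithLp.sub_snd, inner_sub_right] at *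
  linarith

theorem inner_saddleOperator_nonneg (hf : Differentiable ℝ f) (hcc : IsConvexConcave f)
    {zstar : PairSpace m n} (hs : IsGlobalSaddle f zstar) (z : PairSpace m n) :
    0 ≤ ⟪saddleOperator f z, z - zstar⟫ := by
  have h1 := gap_le_inner hf hcc z zstar
  have h2 := hs z.fst z.snd
  linarith

/-- A uniform bound on the differences bounds supremum minus infimum; the balls only have to be
nonempty, which is where β ≥ 0 enters. -/
theorem isEpsGlobalSaddle_of_forall {zstar : PairSpace m n} {β ε : ℝ} (hβ : 0 ≤ β)
    {w : PairSpace m n} (hw : ‖w - zstar‖ ≤ β)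
    (h : ∀ x y, ‖x - zstar.fst‖ ≤ β → ‖y - zstar.snd‖ ≤ β →
      f (mkPair w.fst y) - f (mkPair x w.snd) ≤ ε) :
    IsEpsGlobalSaddle f zstar β ε w := by
  refine ⟨max_le ?_ ?_, ?_⟩
  · exact (WithLp.norm_fst_le _ (w - zstar)).trans hw
  · exact (WithLp.norm_snd_le _ (w - zstar)).trans hw
  · have hne1 : (Metric.closedBall zstar.fst β).Nonempty := ⟨_, Metric.mem_closedBall_self hβ⟩
    have hne2 : (Metric.closedBall zstar.snd β).Nonempty := ⟨_, Metric.mem_closedBall_self hβ⟩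
    unfold restrictedGap
    rw [sub_le_iff_le_add, ← sub_le_iff_le_add']
    refine le_csInf (hne1.image _) ?_
    rintro _ ⟨x, hx, rfl⟩
    rw [sub_le_iff_le_add]
    refine csSup_le (hne2.image _) ?_
    rintro _ ⟨y, hy, rfl⟩
    have := h x y (by simpa [dist_eq_norm] using hx) (by simpa [dist_eq_norm] using hy)
    simp only
    linarith

theorem IsGlobalSaddle.isEpsGlobalSaddle {zstar w : PairSpace m n} (hs : IsGlobalSaddle f w)
    {β ε : ℝ} (hε : 0 ≤ ε) (hw : ‖w - zstar‖ ≤ β) : IsEpsGlobalSaddle f zstar β ε w :=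
  isEpsGlobalSaddle_of_forall ((norm_nonneg _).trans hw) hw fun x y _ _ => by
    have h1 := hs x y
    linarith [h1.1, h1.2]

/-- Jensen in each block separately, for the convex f(·, y) and the concave f(x, ·). -/
theorem average_gap_le (hcc : IsConvexConcave f) {ι : Type*} (t : Finset ι) {a : ι → ℝ}
    (ha : ∀ k ∈ t, 0 ≤ a k) (hpos : 0 < ∑ k ∈ t, a k) (z : ι → PairSpace m n)
    (x : EuclideanSpace ℝ (Fin m)) (y : EuclideanSpace ℝ (Fin n)) :
    (∑ k ∈ t, a k) * (f (mkPair ((∑ k ∈ t, a k)⁻¹ • ∑ k ∈ t, a k • z k).fst y) -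
      f (mkPair x ((∑ k ∈ t, a k)⁻¹ • ∑ k ∈ t, a k • z k).snd)) ≤
      ∑ k ∈ t, a k * (f (mkPair (z k).fst y) - f (mkPair x (z k).snd)) := by
  set Λ := ∑ k ∈ t, a k
  have hw : ∀ k ∈ t, 0 ≤ Λ⁻¹ * a k := fun k hk => mul_nonneg (by positivity) (ha k hk)
  have hw1 : ∑ k ∈ t, Λ⁻¹ * a k = 1 := by rw [← Finset.mul_sum, inv_mul_cancel₀ hpos.ne']
  have hfst : (Λ⁻¹ • ∑ k ∈ t, a k • z k).fst = ∑ k ∈ t, (Λ⁻¹ * a k) • (z k).fst := by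
    have := map_sum (WithLp.fstL 2 ℝ (EuclideanSpace ℝ (Fin m)) (EuclideanSpace ℝ (Fin n)))
      (fun k => (Λ⁻¹ * a k) • z k) t
    rw [Finset.smul_sum]
    simp only [smul_smul]
    exact this
  have hsnd : (Λ⁻¹ • ∑ k ∈ t, a k • z k).snd = ∑ k ∈ t, (Λ⁻¹ * a k) • (z k).snd := by
    have := map_sum (WithLp.sndL 2 ℝ (EuclideanSpace ℝ (Fin m)) (EuclideanSpace ℝ (Fin n)))
      (fun k => (Λ⁻¹ * a k) • z k) t
    rw [Finset.smul_sum]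
    simp only [smul_smul]
    exact this
  have h1 := (hcc.1 y).map_sum_le hw hw1 (p := fun k => (z k).fst) fun _ _ => Set.mem_univ _
  have h2 := (hcc.2 x).le_map_sum hw hw1 (p := fun k => (z k).snd) fun _ _ => Set.mem_univ _
  rw [← hfst] at h1
  rw [← hsnd] at h2
  simp only [smul_eq_mul, mul_assoc, ← Finset.mul_sum] at h1 h2
  rw [inv_mul_eq_div, le_div_iff₀ hpos] at h1
  rw [inv_mul_eq_div, div_le_iff₀ hpos] at h2
  simp only [mul_sub, Finset.sum_sub_distrib]
  linarith

theorem norm_average_sub_le {E : Type*} [NormedAddCommGroup E] [NormedSpace ℝ E] {ι : Type*}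
    (t : Finset ι) {a : ι → ℝ}
    (ha : ∀ k ∈ t, 0 ≤ a k) (hpos : 0 < ∑ k ∈ t, a k) {z : ι → E} {c : E}
    {β : ℝ} (hz : ∀ k ∈ t, ‖z k - c‖ ≤ β) :
    ‖(∑ k ∈ t, a k)⁻¹ • ∑ k ∈ t, a k • z k - c‖ ≤ β := by
  have := (convex_closedBall c β).centerMass_mem ha hpos
    (fun k hk => by simpa [dist_eq_norm] using hz k hk)
  simpa [Finset.centerMass, dist_eq_norm] using this

/-- The facts about one sample path on which the analysis rests. -/
structure IsDescentPath (f : PairSpace m n → ℝ) (ρ : ℝ) (T : ℕ)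
    (z zhat d : ℕ → PairSpace m n) (lam : ℕ → ℝ) : Prop where
  init : zhat 0 = z 0
  frozen : ∀ k < T, IsGlobalSaddle f (z k) ∨ IsGlobalSaddle f (zhat k) →
    z (k + 1) = z k ∧ zhat (k + 1) = zhat k
  lam_pos : ∀ k < T, ¬ (IsGlobalSaddle f (z k) ∨ IsGlobalSaddle f (zhat k)) → 0 < lam (k + 1)
  lam_ge : ∀ k < T, ¬ (IsGlobalSaddle f (z k) ∨ IsGlobalSaddle f (zhat k)) →
    1 / 15 ≤ lam (k + 1) * ρ * ‖d k‖
  update : ∀ k < T, ¬ (IsGlobalSaddle f (z k) ∨ IsGlobalSaddle f (zhat k)) →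
    z (k + 1) = zhat k + d k
  descent : ∀ k < T, ¬ (IsGlobalSaddle f (z k) ∨ IsGlobalSaddle f (zhat k)) → ∀ w,
    lam (k + 1) * ⟪saddleOperator f (z (k + 1)), z (k + 1) - w⟫ ≤
      1 / 2 * ‖zhat k - w‖ ^ 2 - 1 / 2 * ‖zhat (k + 1) - w‖ ^ 2 - 1 / 12 * ‖d k‖ ^ 2

variable {ρ : ℝ} {T : ℕ} {z zhat d : ℕ → PairSpace m n} {lam : ℕ → ℝ}

/-- At w = z⋆ the left side of the descent inequality is nonnegative. Hence ẑ does not move away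
from z⋆, and ‖d k‖² ≤ 6‖ẑ_k - z⋆‖², so a step is at most 3 initial distances long and z_{k+1} is
within 1 + 3 of them. -/
theorem IsDescentPath.bounded (h : IsDescentPath f ρ T z zhat d lam) (hf : Differentiable ℝ f)
    (hcc : IsConvexConcave f) {zstar : PairSpace m n} (hs : IsGlobalSaddle f zstar) :
    ∀ k ≤ T, ‖zhat k - zstar‖ ≤ ‖z 0 - zstar‖ ∧ ‖z k - zstar‖ ≤ 4 * ‖z 0 - zstar‖ := by
  intro k
  induction k with
  | zero =>
    intro _
    rw [h.init]
    exact ⟨le_rfl, by linarith [norm_nonneg (z 0 - zstar)]⟩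
  | succ k ih =>
    intro hk
    obtain ⟨h1, h2⟩ := ih (by omega)
    by_cases hst : IsGlobalSaddle f (z k) ∨ IsGlobalSaddle f (zhat k)
    · obtain ⟨e1, e2⟩ := h.frozen k hk hst
      rw [e1, e2]
      exact ⟨h1, h2⟩
    · have hd := h.descent k hk hst zstar
      have hpos := mul_nonneg (h.lam_pos k hk hst).le
        (inner_saddleOperator_nonneg hf hcc hs (z (k + 1)))
      have hD := norm_nonneg (z 0 - zstar)
      have hsq : ‖zhat k - zstar‖ ^ 2 ≤ ‖z 0 - zstar‖ ^ 2 := by gcongr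
      have h3 : ‖zhat (k + 1) - zstar‖ ≤ ‖z 0 - zstar‖ := by
        refine le_of_sq_le_sq ?_ hD
        nlinarith [sq_nonneg ‖d k‖]
      have h4 : ‖d k‖ ≤ 3 * ‖z 0 - zstar‖ := by
        refine le_of_sq_le_sq ?_ (by positivity)
        nlinarith [sq_nonneg ‖zhat (k + 1) - zstar‖]
      refine ⟨h3, ?_⟩
      rw [h.update k hk hst, add_sub_right_comm]
      exact (norm_add_le _ _).trans (by linarith)

theorem IsDescentPath.stops_mono (h : IsDescentPath f ρ T z zhat d lam) {k : ℕ} (hk : k < T)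
    (hst : IsGlobalSaddle f (z k) ∨ IsGlobalSaddle f (zhat k)) :
    IsGlobalSaddle f (z (k + 1)) ∨ IsGlobalSaddle f (zhat (k + 1)) := by
  obtain ⟨e1, e2⟩ := h.frozen k hk hst
  rwa [e1, e2]

/-- A stopped path is frozen, so a success of the test persists up to index T - 1, the last one
tested. -/
theorem IsDescentPath.not_stops (h : IsDescentPath f ρ T z zhat d lam)
    (hst : ¬ (IsGlobalSaddle f (z (T - 1)) ∨ IsGlobalSaddle f (zhat (T - 1)))) {k : ℕ}
    (hk : k < T) : ¬ (IsGlobalSaddle f (z k) ∨ IsGlobalSaddle f (zhat k)) := by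
  intro hcon
  have key : ∀ j, k ≤ j → j < T → IsGlobalSaddle f (z j) ∨ IsGlobalSaddle f (zhat j) := by
    intro j hj
    induction j, hj using Nat.le_induction with
    | base => exact fun _ => hcon
    | succ j _ ih => exact fun hjT => h.stops_mono (by omega) (ih (by omega))
  exact hst (key (T - 1) (by omega) (by omega))

theorem sum_Icc_one_eq_sum_range {M : Type*} [AddCommMonoid M] (g : ℕ → M) (T : ℕ) :
    ∑ k ∈ Finset.Icc 1 T, g k = ∑ k ∈ Finset.range T, g (k + 1) := by
  induction T with
  | zero => simp
  | succ T ih => rw [Finset.sum_Icc_succ_top (by omega), ih, Finset.sum_range_succ]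

/-- The distances to w telescope; the comparison point w stays free for the gap estimate. -/
theorem IsDescentPath.sum_descent (h : IsDescentPath f ρ T z zhat d lam)
    (hst : ¬ (IsGlobalSaddle f (z (T - 1)) ∨ IsGlobalSaddle f (zhat (T - 1))))
    (w : PairSpace m n) :
    ∑ k ∈ Finset.range T, lam (k + 1) * ⟪saddleOperator f (z (k + 1)), z (k + 1) - w⟫ +
      1 / 12 * ∑ k ∈ Finset.range T, ‖d k‖ ^ 2 ≤ 1 / 2 * ‖z 0 - w‖ ^ 2 := by
  have h1 : ∑ k ∈ Finset.range T,
      (lam (k + 1) * ⟪saddleOperator f (z (k + 1)), z (k + 1) - w⟫ + 1 / 12 * ‖d k‖ ^ 2) ≤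
      ∑ k ∈ Finset.range T, (1 / 2 * ‖zhat k - w‖ ^ 2 - 1 / 2 * ‖zhat (k + 1) - w‖ ^ 2) :=
    Finset.sum_le_sum fun k hk => by
      have hk := Finset.mem_range.1 hk
      linarith [h.descent k hk (h.not_stops hst hk) w]
  rw [Finset.sum_add_distrib, ← Finset.mul_sum,
    Finset.sum_range_sub' (fun k => 1 / 2 * ‖zhat k - w‖ ^ 2), h.init] at h1
  linarith [sq_nonneg ‖zhat T - w‖]

/-- The stepsizes add up to order `T^{3/2}`. -/
theorem IsDescentPath.sum_lam_ge (h : IsDescentPath f ρ T z zhat d lam) (hT : 0 < T)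
    (hf : Differentiable ℝ f) (hcc : IsConvexConcave f) {zstar : PairSpace m n}
    (hs : IsGlobalSaddle f zstar) (hD : 0 < ‖z 0 - zstar‖)
    (hst : ¬ (IsGlobalSaddle f (z (T - 1)) ∨ IsGlobalSaddle f (zhat (T - 1)))) :
    T * √T ≤ 45 * ρ * ‖z 0 - zstar‖ * ∑ k ∈ Finset.range T, lam (k + 1) := by
  have hdpos : ∀ k < T, 0 < ‖d k‖ := fun k hk => by
    have h1 := h.lam_ge k hk (h.not_stops hst hk)
    rcases (norm_nonneg (d k)).eq_or_lt with h0 | h0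
    · rw [← h0] at h1; norm_num at h1
    · exact h0
  -- At w = z⋆ the inner products can be dropped, leaving (1/12)∑‖d k‖² ≤ ½‖z 0 - z⋆‖².
  have hsq : ∑ k ∈ Finset.range T, ‖d k‖ ^ 2 ≤ 6 * ‖z 0 - zstar‖ ^ 2 := by
    have h1 := h.sum_descent hst zstar
    have h2 : 0 ≤ ∑ k ∈ Finset.range T,
        lam (k + 1) * ⟪saddleOperator f (z (k + 1)), z (k + 1) - zstar⟫ :=
      Finset.sum_nonneg fun k hk => by
        have hk := Finset.mem_range.1 hk
        exact mul_nonneg (h.lam_pos k hk (h.not_stops hst hk)).le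
          (inner_saddleOperator_nonneg hf hcc hs _)
    linarith
  have h1 := sum_one_div_ge hT hD hdpos hsq
  have h2 : ∑ k ∈ Finset.range T, 1 / ‖d k‖ ≤ ∑ k ∈ Finset.range T, 15 * ρ * lam (k + 1) :=
    Finset.sum_le_sum fun k hk => by
      have hk := Finset.mem_range.1 hk
      rw [div_le_iff₀ (hdpos k hk)]
      linarith [h.lam_ge k hk (h.not_stops hst hk)]
  rw [← Finset.mul_sum] at h2
  rw [div_le_iff₀ (by positivity)] at h1
  nlinarith [mul_le_mul_of_nonneg_right h2 (by positivity : 0 ≤ 3 * ‖z 0 - zstar‖)]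

/-- The iteration count, without fractional powers. -/
theorem le_mul_sqrt_of_rpow_le {q t : ℝ} (hq : 0 ≤ q) (ht : 400 * q ^ (2 / 3 : ℝ) ≤ t) :
    8000 * q ≤ t * √t := by
  set r := q ^ (1 / 3 : ℝ) with hr
  have hr0 : 0 ≤ r := Real.rpow_nonneg hq _
  have e1 : q ^ (2 / 3 : ℝ) = r ^ 2 := by
    rw [hr, ← Real.rpow_natCast, ← Real.rpow_mul hq]; norm_num
  have e2 : q = r ^ 3 := by
    rw [hr, ← Real.rpow_natCast, ← Real.rpow_mul hq]; norm_num
  rw [e1] at ht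
  have ht0 : 0 ≤ t := le_trans (by positivity) ht
  have h1 : 20 * r ≤ √t := Real.le_sqrt_of_sq_le (by nlinarith)
  rw [e2]
  calc 8000 * r ^ 3 = (400 * r ^ 2) * (20 * r) := by ring
    _ ≤ t * √t := mul_le_mul ht h1 (by positivity) ht0

/-- The average of a path that does not stop is an `ε`-global saddle point. -/
theorem IsDescentPath.average_isEpsGlobalSaddle (h : IsDescentPath f ρ T z zhat d lam)
    (hρ : 0 < ρ) (hT : 0 < T) (hf : Differentiable ℝ f) (hcc : IsConvexConcave f)
    {zstar : PairSpace m n} (hs : IsGlobalSaddle f zstar)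
    (hst : ¬ (IsGlobalSaddle f (z (T - 1)) ∨ IsGlobalSaddle f (zhat (T - 1)))) {ε : ℝ} (hε : 0 < ε)
    (hTε : 400 * (ρ * ‖z 0 - zstar‖ ^ 3 / ε) ^ (2 / 3 : ℝ) ≤ T) :
    IsEpsGlobalSaddle f zstar (8 * ‖z 0 - zstar‖) ε
      ((∑ k ∈ Finset.Icc 1 T, lam k)⁻¹ • ∑ k ∈ Finset.Icc 1 T, lam k • z k) := by
  -- If z 0 were the saddle point z⋆, the test would have succeeded at k = 0.
  have hD : 0 < ‖z 0 - zstar‖ := by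
    rw [norm_pos_iff, sub_ne_zero]
    intro h0
    exact h.not_stops hst hT (Or.inl (h0 ▸ hs))
  have hΛ := h.sum_lam_ge hT hf hcc hs hD hst
  have hTR : (0 : ℝ) < T := by exact_mod_cast hT
  have hpos : 0 < ∑ k ∈ Finset.range T, lam (k + 1) := by
    have : 0 < T * √(T : ℝ) := by positivity
    by_contra! hcon
    nlinarith [mul_nonneg (by positivity : 0 ≤ 45 * ρ * ‖z 0 - zstar‖) (neg_nonneg.2 hcon)]
  have hlam : ∀ k ∈ Finset.range T, 0 ≤ lam (k + 1) := fun k hk =>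
    (h.lam_pos k (Finset.mem_range.1 hk) (h.not_stops hst (Finset.mem_range.1 hk))).le
  rw [sum_Icc_one_eq_sum_range, sum_Icc_one_eq_sum_range]
  refine isEpsGlobalSaddle_of_forall (by positivity)
    (norm_average_sub_le _ hlam hpos fun k hk => ?_) fun x y hx hy => ?_
  · have := (h.bounded hf hcc hs (k + 1) (Finset.mem_range.1 hk)).2
    linarith
  · have h1 := average_gap_le hcc (Finset.range T) hlam hpos (fun k => z (k + 1)) x y
    have h2 : ∑ k ∈ Finset.range T, lam (k + 1) *
        (f (mkPair (z (k + 1)).fst y) - f (mkPair x (z (k + 1)).snd)) ≤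
        1 / 2 * ‖z 0 - mkPair x y‖ ^ 2 := by
      refine le_trans (Finset.sum_le_sum fun k hk => mul_le_mul_of_nonneg_left
        (gap_le_inner hf hcc (z (k + 1)) (mkPair x y)) (hlam k hk)) ?_
      have := h.sum_descent hst (mkPair x y)
      have h0 : 0 ≤ ∑ k ∈ Finset.range T, ‖d k‖ ^ 2 := Finset.sum_nonneg fun _ _ => sq_nonneg _
      linarith
    -- Two blocks of radius 8D give distance 8√2 D ≤ 12D from z⋆; one more D reaches z 0.
    have h3 : ‖z 0 - mkPair x y‖ ≤ 13 * ‖z 0 - zstar‖ := by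
      have e1 : ‖mkPair x y - zstar‖ ≤ 12 * ‖z 0 - zstar‖ := by
        refine le_of_sq_le_sq ?_ (by positivity)
        rw [WithLp.prod_norm_sq_eq_of_L2]
        have e2 : ‖x - zstar.fst‖ ^ 2 ≤ (8 * ‖z 0 - zstar‖) ^ 2 := by gcongr
        have e3 : ‖y - zstar.snd‖ ^ 2 ≤ (8 * ‖z 0 - zstar‖) ^ 2 := by gcongr
        simp only [WithLp.sub_fst, WithLp.sub_snd, WithLp.toLp_fst, WithLp.toLp_snd]
        nlinarith
      have e4 : z 0 - mkPair x y = (z 0 - zstar) - (mkPair x y - zstar) := by abel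
      rw [e4]
      exact (norm_sub_le _ _).trans (by linarith)
    have h4 : ‖z 0 - mkPair x y‖ ^ 2 ≤ 169 * ‖z 0 - zstar‖ ^ 2 := by
      calc _ ≤ (13 * ‖z 0 - zstar‖) ^ 2 := by gcongr
        _ = _ := by ring
    have h5 := le_mul_sqrt_of_rpow_le (by positivity) hTε
    have h6 : 8000 * (ρ * ‖z 0 - zstar‖ ^ 3) ≤
        ε * (45 * ρ * ‖z 0 - zstar‖ * ∑ k ∈ Finset.range T, lam (k + 1)) := by
      have := mul_le_mul_of_nonneg_left (h5.trans hΛ) hε.le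
      rw [← mul_assoc, mul_comm ε 8000, mul_assoc, mul_div_cancel₀ _ hε.ne'] at this
      exact this
    -- This holds because 8000/45 exceeds 169/2.
    have h7 : 1 / 2 * (169 * ‖z 0 - zstar‖ ^ 2) ≤ (∑ k ∈ Finset.range T, lam (k + 1)) * ε := by
      have hk : 0 < ρ * ‖z 0 - zstar‖ := by positivity
      refine le_of_mul_le_mul_left ?_ hk
      have : 0 ≤ ρ * ‖z 0 - zstar‖ ^ 3 := by positivity
      nlinarith
    exact le_of_mul_le_mul_left (by linarith) hpos

end Pair

/-! ### Pathwise bounds and measurability for the sampled Hessians -/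

/-- An average of operators of norm at most W, whatever the sample. For the empty list, division by
zero makes it 0. -/
theorem norm_and_symm_subsampledHessian {m n N : ℕ} {f : Fin N → PairSpace m n → ℝ}
    (hf : ∀ i, ContDiff ℝ 2 (f i)) {p : Fin N → ℝ} {z : PairSpace m n} {W : ℝ} (hW0 : 0 ≤ W)
    (hW : ∀ i, ‖(1 / (N * p i)) • hess (f i) z‖ ≤ W) (l : List (Fin N)) :
    ‖subsampledHessian f p l z‖ ≤ W ∧
      (subsampledHessian f p l z : PairSpace m n →ₗ[ℝ] PairSpace m n).IsSymmetric := by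
  rcases Nat.eq_zero_or_pos l.length with h0 | hpos
  · rw [List.length_eq_zero_iff] at h0
    subst h0
    have h1 : subsampledHessian f p [] z = 0 := by simp [subsampledHessian]
    rw [h1]
    exact ⟨by simpa using hW0, fun x y => by simp⟩
  · have h1 := subsampledHessian_ofFn_sub hpos f p z 0 l.get
    rw [List.ofFn_get, sub_zero] at h1
    rw [h1]
    refine ⟨?_, isSymmetric_smul (isSymmetric_centredSum
      (fun i => isSymmetric_smul (isSymmetric_hess (hf i) z) _) (fun x y => by simp) _) _⟩
    have hR : (0 : ℝ) < l.length := by exact_mod_cast hpos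
    rw [norm_smul, Real.norm_of_nonneg (by positivity), one_div, inv_mul_le_iff₀ hR]
    refine (norm_sum_le _ _).trans ?_
    refine (Finset.sum_le_card_nsmul _ _ W fun k _ => ?_).trans (le_of_eq ?_)
    · rw [sub_zero]; exact hW _
    · simp

theorem IsSamplingSchemeFor.norm_and_symm {m n N : ℕ} (hN : 0 < N)
    {f : Fin N → PairSpace m n → ℝ} (hf : ∀ i, ContDiff ℝ 2 (f i)) {S : SamplingScheme m n N}
    (hS : IsSamplingSchemeFor f S) (z : PairSpace m n) (l : List (Fin N)) :
    0 ≤ S.Bmax ∧ ‖subsampledHessian f (S.prob z) l z‖ ≤ S.Bmax ∧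
      (subsampledHessian f (S.prob z) l z : PairSpace m n →ₗ[ℝ] PairSpace m n).IsSymmetric := by
  have hNR : (0 : ℝ) < N := by exact_mod_cast hN
  have huni : ∀ B : Fin N → ℝ, (∀ i z, ‖hess (f i) z‖ ≤ B i) →
      0 ≤ (⨆ i, B i) ∧ ‖subsampledHessian f (fun _ => 1 / (N : ℝ)) l z‖ ≤ (⨆ i, B i) ∧
      (subsampledHessian f (fun _ => 1 / (N : ℝ)) l z :
        PairSpace m n →ₗ[ℝ] PairSpace m n).IsSymmetric := fun B hB => by
    have h1 : ∀ i, ‖hess (f i) z‖ ≤ ⨆ i, B i := fun i =>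
      (hB i z).trans (le_ciSup (Set.finite_range B).bddAbove i)
    have h2 : 0 ≤ ⨆ i, B i := (norm_nonneg _).trans (h1 ⟨0, hN⟩)
    exact ⟨h2, norm_and_symm_subsampledHessian hf h2 (fun i => by simpa [hNR.ne'] using h1 i) l⟩
  cases hS with
  | uniform_with B hB => exact huni B hB
  | uniform_without B hB => exact huni B hB
  | nonuniform φ a b B hφ hfφ hB =>
    have h1 := norm_scaled_hess_importance_le hφ hfφ hB z
    have h0 : 0 ≤ (1 / (N : ℝ)) * ∑ i, B i := (norm_nonneg _).trans (h1 ⟨0, hN⟩)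
    have h2 : (1 / (N : ℝ)) * ∑ i, B i ≤ ⨆ i, B i := by
      rw [one_div, inv_mul_le_iff₀ hNR]
      refine (Finset.sum_le_card_nsmul _ _ (⨆ i, B i) fun i _ =>
        le_ciSup (Set.finite_range B).bddAbove i).trans (le_of_eq ?_)
      simp
    obtain ⟨h3, h4⟩ := norm_and_symm_subsampledHessian hf h0 h1 l
    exact ⟨h0.trans h2, h3.trans h2, h4⟩

theorem continuous_importanceWeight {m n : ℕ} {φ : WithLp 2 (ℝ × ℝ) → ℝ} (hφ : ContDiff ℝ 2 φ)
    (a : EuclideanSpace ℝ (Fin m)) (b : EuclideanSpace ℝ (Fin n)) :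
    Continuous (importanceWeight φ a b) :=
  (((continuous_hess hφ).comp (planeMap a b).continuous).norm).mul continuous_const

theorem IsSamplingSchemeFor.measurable_prob {m n N : ℕ} {f : Fin N → PairSpace m n → ℝ}
    {S : SamplingScheme m n N} (hS : IsSamplingSchemeFor f S) (i : Fin N) :
    Measurable fun z => S.prob z i := by
  cases hS with
  | uniform_with B hB => exact measurable_const
  | uniform_without B hB => exact measurable_const
  | nonuniform φ a b B hφ hfφ hB =>
    have h1 : Measurable fun z => ∑ j, importanceWeight (φ j) (a j) (b j) z :=
      Finset.measurable_fun_sum _ fun j _ => (continuous_importanceWeight (hφ j) _ _).measurable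
    exact Measurable.ite (h1 (measurableSet_singleton 0)) measurable_const
      ((continuous_importanceWeight (hφ i) _ _).measurable.div h1)

theorem measurable_norm_weighted_list_sum_sub {Z F ι : Type*} [MeasurableSpace Z]
    [NormedAddCommGroup F] [NormedSpace ℝ F] {p : Z → ι → ℝ} (hp : ∀ i, Measurable fun z => p z i)
    {A : ι → Z → F} (hA : ∀ i, StronglyMeasurable (A i)) {M : Z → F} (hM : StronglyMeasurable M)
    (c : ℝ) (l : List ι) :
    Measurable fun z => ‖c • (l.map fun i => (1 / p z i) • A i z).sum - M z‖ := by
  have h1 : StronglyMeasurable fun z => (l.map fun i => (1 / p z i) • A i z).sum := by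
    induction l with
    | nil => exact stronglyMeasurable_const
    | cons i l ih =>
      simp only [List.map_cons, List.sum_cons]
      exact (((hp i).const_div 1).stronglyMeasurable.smul (hA i)).add ih
  exact ((h1.const_smul c).sub hM).norm.measurable

theorem IsSamplingSchemeFor.measurable_norm_sub {m n N : ℕ} {f : Fin N → PairSpace m n → ℝ}
    (hf : ∀ i, ContDiff ℝ 2 (f i)) {S : SamplingScheme m n N} (hS : IsSamplingSchemeFor f S)
    (l : List (Fin N)) :
    Measurable fun z => ‖subsampledHessian f (S.prob z) l z - hess (finiteSum f) z‖ :=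
  measurable_norm_weighted_list_sum_sub hS.measurable_prob
    (fun i => (continuous_hess (hf i)).stronglyMeasurable)
    (continuous_hess (contDiff_finiteSum hf)).stronglyMeasurable _ l

/-- Closedness makes the stopping event measurable with respect to the past. -/
theorem isClosed_isGlobalSaddle {m n : ℕ} {f : PairSpace m n → ℝ} (hf : Continuous f) :
    IsClosed {w | IsGlobalSaddle f w} := by
  have h1 : ∀ y, Continuous fun w : PairSpace m n => f (mkPair w.fst y) := fun y =>
    hf.comp (by fun_prop)
  have h2 : ∀ x, Continuous fun w : PairSpace m n => f (mkPair x w.snd) := fun x =>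
    hf.comp (by fun_prop)
  have h3 : {w | IsGlobalSaddle f w} =
      ⋂ x, ⋂ y, ({w | f (mkPair w.fst y) ≤ f w} ∩ {w | f w ≤ f (mkPair x w.snd)}) := by
    ext w
    simp [IsGlobalSaddle]
  rw [h3]
  exact isClosed_iInter fun x => isClosed_iInter fun y =>
    (isClosed_le (h1 y) hf).inter (isClosed_le hf (h2 x))

/-! ### From conditional laws to failure probabilities -/

/-- The probability of a bad draw, when the draw has a known conditional law given the past. -/
theorem measure_bad_draw_le {Ω : Type*} {𝒢 mΩ : MeasurableSpace Ω} {μ : Measure Ω}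
    [IsFiniteMeasure μ] (h𝒢 : 𝒢 ≤ mΩ) {α : Type*} [Countable α] {X : Ω → α} (hX : ∀ l, MeasurableSet {ω | X ω = l}) {bad : α → Set Ω}
    (hbad : ∀ l, MeasurableSet[𝒢] (bad l)) {p : Ω → α → ℝ} {G : Set Ω} (hG : MeasurableSet[𝒢] G)
    (hp : ∀ l, ∀ᵐ ω ∂μ, ω ∈ G → (μ⟦{ω' | X ω' = l} | 𝒢⟧) ω = p ω l) {c : ENNReal}
    (hc : ∀ᵐ ω ∂μ, ω ∈ G → ∑' l, ENNReal.ofReal ({l | ω ∈ bad l}.indicator (p ω) l) ≤ c) :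
    μ (G ∩ {ω | ω ∈ bad (X ω)}) ≤ c * μ G := by
  have hcover : G ∩ {ω | ω ∈ bad (X ω)} ⊆ ⋃ l, {ω | X ω = l} ∩ (G ∩ bad l) := fun ω hω =>
    Set.mem_iUnion.2 ⟨X ω, rfl, hω.1, hω.2⟩
  set q : α → Ω → ℝ := fun l => μ⟦{ω' | X ω' = l} | 𝒢⟧ with hq
  have hqm : ∀ l, Measurable (q l) := fun l =>
    (stronglyMeasurable_condExp.mono h𝒢).measurable
  -- G ∩ bad l belongs to the past, so integrating the conditional probability over it gives the
  -- joint probability.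
  have hone : ∀ l, μ ({ω | X ω = l} ∩ (G ∩ bad l)) =
      ∫⁻ ω in G, (bad l).indicator (fun ω => ENNReal.ofReal (q l ω)) ω ∂μ := fun l => by
    have hA : MeasurableSet[𝒢] (G ∩ bad l) := hG.inter (hbad l)
    have hint : Integrable ({ω | X ω = l}.indicator fun _ => (1 : ℝ)) μ :=
      (integrable_const 1).indicator (hX l)
    have h1 := setIntegral_condExp h𝒢 hint hA
    have hnn : 0 ≤ᵐ[μ] q l := condExp_nonneg
      (Filter.Eventually.of_forall fun ω => Set.indicator_nonneg (fun _ _ => zero_le_one) ω)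
    rw [setIntegral_indicator (hX l), setIntegral_const, smul_eq_mul, mul_one] at h1
    rw [lintegral_indicator (h𝒢 _ (hbad l)), Measure.restrict_restrict (h𝒢 _ (hbad l)),
      Set.inter_comm (bad l) G,
      ← ofReal_integral_eq_lintegral_ofReal integrable_condExp.integrableOn
        (ae_restrict_of_ae hnn), h1, Set.inter_comm]
    exact (ENNReal.ofReal_toReal (measure_ne_top _ _)).symm
  calc μ (G ∩ {ω | ω ∈ bad (X ω)})
      ≤ ∑' l, μ ({ω | X ω = l} ∩ (G ∩ bad l)) :=
        (measure_mono hcover).trans (measure_iUnion_le _)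
    _ = ∫⁻ ω in G, ∑' l, (bad l).indicator (fun ω => ENNReal.ofReal (q l ω)) ω ∂μ := by
        rw [lintegral_tsum fun l =>
          ((hqm l).ennreal_ofReal.indicator (h𝒢 _ (hbad l))).aemeasurable]
        exact tsum_congr hone
    _ ≤ ∫⁻ _ in G, c ∂μ := by
        refine setLIntegral_mono_ae' (h𝒢 _ hG) ?_
        filter_upwards [hc, ae_all_iff.2 hp] with ω h1 h2 hω
        refine le_trans (le_of_eq (tsum_congr fun l => ?_)) (h1 hω)
        by_cases hl : ω ∈ bad l
        · rw [Set.indicator_of_mem hl, Set.indicator_of_mem (by exact hl)]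
          exact congrArg _ (h2 l hω)
        · rw [Set.indicator_of_notMem hl, Set.indicator_of_notMem (by exact hl),
            ENNReal.ofReal_zero]
    _ = c * μ G := by rw [setLIntegral_const]

section Probability

variable {Ω : Type*} {mΩ : MeasurableSpace Ω} {μ : Measure Ω}

/-- If each bad event has conditional probability at most `c` given the past, then none of the first
`T` of them occurs with probability at least `(1 - c)^T`. -/
theorem pow_le_measureReal_biInter_compl [IsProbabilityMeasure μ] {ℱ : Filtration ℕ mΩ}
    {bad : ℕ → Set Ω} {T : ℕ} (hbad : ∀ k < T, MeasurableSet[ℱ (k + 1)] (bad k)) {c : ℝ}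
    (hc1 : c ≤ 1)
    (h : ∀ k < T, ∀ G, MeasurableSet[ℱ k] G → μ.real (G ∩ bad k) ≤ c * μ.real G) :
    MeasurableSet[ℱ T] (⋂ k ∈ Finset.range T, (bad k)ᶜ) ∧
      (1 - c) ^ T ≤ μ.real (⋂ k ∈ Finset.range T, (bad k)ᶜ) := by
  suffices H : ∀ j ≤ T, MeasurableSet[ℱ j] (⋂ k ∈ Finset.range j, (bad k)ᶜ) ∧
      (1 - c) ^ j ≤ μ.real (⋂ k ∈ Finset.range j, (bad k)ᶜ) from H T le_rfl
  intro j
  induction j with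
  | zero => intro _; simp
  | succ j ih =>
    intro hj
    obtain ⟨h1, h2⟩ := ih (by omega)
    have h3 : (⋂ k ∈ Finset.range (j + 1), (bad k)ᶜ) =
        (⋂ k ∈ Finset.range j, (bad k)ᶜ) \ bad j := by
      rw [Finset.range_add_one, Finset.set_biInter_insert, Set.inter_comm, Set.sdiff_eq]
    have hm := hbad j hj
    rw [h3]
    refine ⟨(ℱ.mono (Nat.le_succ j) _ h1).diff hm, ?_⟩
    have h4 := measureReal_sdiff_add_inter (μ := μ) (s := ⋂ k ∈ Finset.range j, (bad k)ᶜ)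
      (ℱ.le _ _ hm)
    -- Here G is the event that no earlier iteration failed. Since the hypothesis holds for every
    -- past event G, no independence is needed.
    have h5 := h j hj _ h1
    rw [pow_succ]
    nlinarith [mul_le_mul_of_nonneg_right h2 (sub_nonneg.2 hc1)]

end Probability

/-! ### Runs of the method -/

section Run

variable {Ω : Type*} {mΩ : MeasurableSpace Ω} {m n N : ℕ} {μ : Measure Ω} {ℱ : Filtration ℕ mΩ}
  {f : Fin N → PairSpace m n → ℝ} {S : SamplingScheme m n N} {ρ κm τ₀ δ : ℝ} {T : ℕ}
  {z0 : PairSpace m n} {P : NewtonProcess Ω m n N}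

/-- The event that iteration `k` is performed with an inaccurate Hessian. -/
def badHessian (P : NewtonProcess Ω m n N) (f : Fin N → PairSpace m n → ℝ)
    (S : SamplingScheme m n N) (k : ℕ) : Set Ω :=
  {ω | ¬ P.Stops (finiteSum f) k ω ∧
    P.tau k ω < ‖P.inexactHess f S k ω - hess (finiteSum f) (P.zhat k ω)‖}

/-- The event that at iteration `k` the list `l` would give an inaccurate Hessian. -/
def badList (P : NewtonProcess Ω m n N) (f : Fin N → PairSpace m n → ℝ)
    (S : SamplingScheme m n N) (k : ℕ) (l : List (Fin N)) : Set Ω :=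
  {ω | P.tau k ω < ‖subsampledHessian f (S.prob (P.zhat k ω)) l (P.zhat k ω) -
    hess (finiteSum f) (P.zhat k ω)‖}

theorem IsSubsampledNewtonRun.measurableSet_stops
    (h : IsSubsampledNewtonRun μ ℱ f S ρ κm τ₀ δ T z0 P) (hf : ∀ i, ContDiff ℝ 2 (f i)) {k : ℕ}
    (hk : k < T) : MeasurableSet[ℱ k] {ω | P.Stops (finiteSum f) k ω} := by
  have hcl := (isClosed_isGlobalSaddle (contDiff_finiteSum hf).continuous).measurableSet
  exact ((h.measurable_z k hk.le).measurable hcl).union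
    ((h.measurable_zhat k hk.le).measurable hcl)

theorem IsSubsampledNewtonRun.measurableSet_badList
    (h : IsSubsampledNewtonRun μ ℱ f S ρ κm τ₀ δ T z0 P) (hf : ∀ i, ContDiff ℝ 2 (f i))
    (hS : IsSamplingSchemeFor f S) {k : ℕ} (hk : k < T) (l : List (Fin N)) :
    MeasurableSet[ℱ k] (badList P f S k l) :=
  measurableSet_lt (h.measurable_tau k hk)
    ((hS.measurable_norm_sub hf l).comp (h.measurable_zhat k hk.le).measurable)

/-- The random list takes countably many values: the event is a union over fixed lists, each badness
being known at time k and the draw at time k + 1. -/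
theorem IsSubsampledNewtonRun.measurableSet_badHessian
    (h : IsSubsampledNewtonRun μ ℱ f S ρ κm τ₀ δ T z0 P) (hf : ∀ i, ContDiff ℝ 2 (f i))
    (hS : IsSamplingSchemeFor f S) {k : ℕ} (hk : k < T) :
    MeasurableSet[ℱ (k + 1)] (badHessian P f S k) := by
  have h1 : badHessian P f S k = {ω | P.Stops (finiteSum f) k ω}ᶜ ∩
      ⋃ l, {ω | P.sample k ω = l} ∩ badList P f S k l := by
    ext ω
    simp only [badHessian, badList, NewtonProcess.inexactHess, Set.mem_inter_iff, Set.mem_iUnion,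
      Set.mem_compl_iff, Set.mem_ofPred_eq]
    constructor
    · exact fun hω => ⟨hω.1, _, rfl, hω.2⟩
    · rintro ⟨h1, l, rfl, h2⟩
      exact ⟨h1, h2⟩
  rw [h1]
  refine (ℱ.mono (Nat.le_succ k) _ (h.measurableSet_stops hf hk)).compl.inter
    (MeasurableSet.iUnion fun l => (h.measurable_sample k hk l).inter
      (ℱ.mono (Nat.le_succ k) _ (h.measurableSet_badList hf hS hk l)))

/-- The law of the sample is prescribed only while the method runs, so G is first intersected with
the past event that it has not stopped. -/
theorem IsSubsampledNewtonRun.measureReal_inter_badHessian_le [IsProbabilityMeasure μ]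
    (h : IsSubsampledNewtonRun μ ℱ f S ρ κm τ₀ δ T z0 P) (hN : 0 < N)
    (hf : ∀ i, ContDiff ℝ 2 (f i)) (hS : IsSamplingSchemeFor f S)
    (hδ : 0 < 1 - (1 - δ) ^ (1 / (T : ℝ))) (hδ1 : 1 - (1 - δ) ^ (1 / (T : ℝ)) ≤ 1) {k : ℕ}
    (hk : k < T) {G : Set Ω} (hG : MeasurableSet[ℱ k] G) :
    μ.real (G ∩ badHessian P f S k) ≤ (1 - (1 - δ) ^ (1 / (T : ℝ))) * μ.real G := by
  set c := 1 - (1 - δ) ^ (1 / (T : ℝ))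
  have hG' : MeasurableSet[ℱ k] (G ∩ {ω | P.Stops (finiteSum f) k ω}ᶜ) :=
    hG.inter (h.measurableSet_stops hf hk).compl
  have h1 := measure_bad_draw_le (μ := μ) (ℱ.le k) (X := P.sample k)
    (fun l => ℱ.le _ _ (h.measurable_sample k hk l))
    (fun l => h.measurableSet_badList hf hS hk l) hG'
    (p := fun ω l => S.law (P.zhat k ω) (P.size k ω) l) (c := ENNReal.ofReal c)
    (fun l => by filter_upwards [h.sample_spec k hk l] with ω hω hωG using hω hωG.2)
    (by
      filter_upwards [h.tau_spec k hk, h.size_spec k hk] with ω h1 h2 hωG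
      exact hS.tsum_law_le hN hf (h2 hωG.2).1 (h1 hωG.2).1 hδ hδ1 (h2 hωG.2).2 (P.zhat k ω))
  have h2 : G ∩ badHessian P f S k = (G ∩ {ω | P.Stops (finiteSum f) k ω}ᶜ) ∩
      {ω | ω ∈ badList P f S k (P.sample k ω)} := by
    ext ω
    simp only [badHessian, badList, NewtonProcess.inexactHess, Set.mem_inter_iff,
      Set.mem_compl_iff, Set.mem_ofPred_eq]
    tauto
  rw [h2]
  have h3 := ENNReal.toReal_mono (by finiteness) h1
  rw [ENNReal.toReal_mul, ENNReal.toReal_ofReal hδ.le] at h3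
  exact h3.trans (mul_le_mul_of_nonneg_left (measureReal_mono Set.inter_subset_left) hδ.le)

/-- Almost every sample path without inaccurate Hessians is a descent path. -/
theorem IsSubsampledNewtonRun.ae_isDescentPath
    (h : IsSubsampledNewtonRun μ ℱ f S ρ κm τ₀ δ T z0 P) (hN : 0 < N)
    (hf : ∀ i, ContDiff ℝ 2 (f i)) (hS : IsSamplingSchemeFor f S) (hρ : 0 < ρ)
    (hL : IsHessianLipschitz ρ (finiteSum f)) (hκ : 0 < κm) (hκ1 : κm < min 1 (ρ / 4))
    (hτ₀ : τ₀ < ρ / 4) :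
    ∀ᵐ ω ∂μ, (∀ k < T, ω ∉ badHessian P f S k) → P.z 0 ω = z0 ∧
      IsDescentPath (finiteSum f) ρ T (fun k => P.z k ω) (fun k => P.zhat k ω)
        (fun k => P.step k ω) (fun k => P.lam k ω) := by
  have e1 : ∀ᵐ ω ∂μ, ∀ k < T, P.Stops (finiteSum f) k ω →
      P.z (k + 1) ω = P.z k ω ∧ P.zhat (k + 1) ω = P.zhat k ω :=
    ae_all_iff.2 fun k => ae_all_iff.2 fun hk => h.frozen k hk
  have e2 := ae_all_iff.2 fun k => ae_all_iff.2 fun hk : k < T => h.tau_spec k hk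
  have e3 := ae_all_iff.2 fun k => ae_all_iff.2 fun hk : k < T => h.step_spec k hk
  have e4 := ae_all_iff.2 fun k => ae_all_iff.2 fun hk : k < T => h.lam_spec k hk
  have e5 := ae_all_iff.2 fun k => ae_all_iff.2 fun hk : k < T => h.update_z k hk
  have e6 := ae_all_iff.2 fun k => ae_all_iff.2 fun hk : k < T => h.update_zhat k hk
  filter_upwards [h.init, e1, e2, e3, e4, e5, e6] with ω h0 h1 h2 h3 h4 h5 h6 hgood
  refine ⟨h0.1, h0.2.trans h0.1.symm, h1, fun k hk hs => (h4 k hk hs).1,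
    fun k hk hs => (h4 k hk hs).2.1, h5, fun k hk hs w => ?_⟩
  have hs' : ¬ P.Stops (finiteSum f) k ω := hs
  have hacc : ‖P.inexactHess f S k ω - hess (finiteSum f) (P.zhat k ω)‖ ≤ P.tau k ω := by
    by_contra! hcon
    exact hgood k hk ⟨hs', hcon⟩
  obtain ⟨hB, hHB, hH⟩ := hS.norm_and_symm hN hf (P.zhat k ω) (P.sample k ω)
  have := newton_step (contDiff_finiteSum hf) hL hρ hκ hκ1 hτ₀ hB hH hHB hacc (h2 k hk hs').2
    (h3 k hk hs') (h4 k hk hs').1 (h4 k hk hs').2.1 (h4 k hk hs').2.2 w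
  simp only [h6 k hk hs', h5 k hk hs']
  exact this

end Run

theorem mainTheorem3 :
    ∃ C : ℝ, 0 < C ∧
    ∀ (m n N : ℕ) (_ : 0 < N) (f : Fin N → PairSpace m n → ℝ) (_ : ∀ i, ContDiff ℝ 2 (f i))
      (ρ : ℝ) (_ : 0 < ρ)
      (_ : IsConvexConcave (finiteSum f)) (_ : IsHessianLipschitz ρ (finiteSum f))
      (zstar : PairSpace m n) (_ : IsGlobalSaddle (finiteSum f) zstar)
      (S : SamplingScheme m n N) (_ : IsSamplingSchemeFor f S)
      (κm : ℝ) (_ : 0 < κm) (_ : κm < min 1 (ρ / 4))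
      (τ₀ : ℝ) (_ : 0 < τ₀) (_ : τ₀ < ρ / 4)
      (δ : ℝ) (_ : 0 < δ) (_ : δ < 1)
      (T : ℕ) (_ : 1 ≤ T) (z0 : PairSpace m n)
      (Ω : Type*) (mΩ : MeasurableSpace Ω) (μ : Measure Ω) (_ : IsProbabilityMeasure μ)
      (ℱ : Filtration ℕ mΩ) (P : NewtonProcess Ω m n N)
      (_ : IsSubsampledNewtonRun μ ℱ f S ρ κm τ₀ δ T z0 P),
      (∀ k < T,
        μ.real {ω | ¬ P.Stops (finiteSum f) k ω ∧
          P.tau k ω < ‖P.inexactHess f S k ω - hess (finiteSum f) (P.zhat k ω)‖} ≤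
        1 - (1 - δ) ^ (1 / (T : ℝ))) ∧
      ∃ A : Set Ω, MeasurableSet A ∧ 1 - δ ≤ μ.real A ∧ ∀ ω ∈ A,
        (∀ k ≤ T, ‖P.z k ω - zstar‖ ≤ 8 * ‖z0 - zstar‖ ∧
          ‖P.zhat k ω - zstar‖ ≤ 8 * ‖z0 - zstar‖) ∧
        ∀ ε : ℝ, 0 < ε → C * (ρ * ‖z0 - zstar‖ ^ 3 / ε) ^ (2 / 3 : ℝ) ≤ T →
          IsEpsGlobalSaddle (finiteSum f) zstar (8 * ‖z0 - zstar‖) ε (P.output (finiteSum f) T ω) := by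
  refine ⟨400, by norm_num, ?_⟩
  intro m n N hN f hf ρ hρ hcc hL zstar hs S hS κm hκ hκ1 τ₀ _ hτ₀' δ hδ hδ1 T hT z0 Ω mΩ μ _ ℱ P h
  have hTR : (0 : ℝ) < T := by exact_mod_cast hT
  have h1δ : 0 < 1 - δ := by linarith
  -- The choice of δ_T makes the T conditional success factors multiply to exactly 1 - δ.
  have hpow : (1 - (1 - (1 - δ) ^ (1 / (T : ℝ)))) ^ T = 1 - δ := by
    rw [sub_sub_cancel, ← Real.rpow_natCast, ← Real.rpow_mul h1δ.le, one_div_mul_cancel hTR.ne',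
      Real.rpow_one]
  have hc0 : 0 < 1 - (1 - δ) ^ (1 / (T : ℝ)) :=
    sub_pos.2 (Real.rpow_lt_one h1δ.le (by linarith) (by positivity))
  have hc1 : 1 - (1 - δ) ^ (1 / (T : ℝ)) ≤ 1 := by
    linarith [Real.rpow_nonneg h1δ.le (1 / (T : ℝ))]
  have hbound : ∀ k < T, ∀ G, MeasurableSet[ℱ k] G → μ.real (G ∩ badHessian P f S k) ≤
      (1 - (1 - δ) ^ (1 / (T : ℝ))) * μ.real G := fun k hk G hG =>
    h.measureReal_inter_badHessian_le hN hf hS hc0 hc1 hk hG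
  refine ⟨fun k hk => ?_, ?_⟩
  · have := hbound k hk Set.univ MeasurableSet.univ
    simpa [badHessian] using this
  obtain ⟨hGm, hGp⟩ := pow_le_measureReal_biInter_compl
    (fun k hk => h.measurableSet_badHessian hf hS hk) hc1 hbound
  rw [hpow] at hGp
  obtain ⟨A, hA, hAm, hAp⟩ :=
    (h.ae_isDescentPath hN hf hS hρ hL hκ hκ1 hτ₀').exists_measurable_mem
  -- All samples are accurate, and the almost sure properties of the run hold; intersecting with the
  -- full-measure set A costs no probability.
  refine ⟨(⋂ k ∈ Finset.range T, (badHessian P f S k)ᶜ) ∩ A, (ℱ.le T _ hGm).inter hAm, ?_, ?_⟩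
  · rwa [measureReal_congr (Filter.inter_eventuallyEq_left.2
      (Filter.Eventually.mono hA fun ω hω _ => hω))]
  rintro ω ⟨hωG, hωA⟩
  have hgood : ∀ k < T, ω ∉ badHessian P f S k := fun k hk =>
    Set.mem_iInter₂.1 hωG k (Finset.mem_range.2 hk)
  obtain ⟨hz0, hpath⟩ := hAp ω hωA hgood
  have hdiff : Differentiable ℝ (finiteSum f) :=
    (contDiff_finiteSum hf).differentiable (by norm_num)
  have hD := norm_nonneg (z0 - zstar)
  have hbdd : ∀ k ≤ T, ‖P.z k ω - zstar‖ ≤ 8 * ‖z0 - zstar‖ ∧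
      ‖P.zhat k ω - zstar‖ ≤ 8 * ‖z0 - zstar‖ := fun k hk => by
    have := hpath.bounded hdiff hcc hs k hk
    simp only [hz0] at this
    exact ⟨by linarith [this.2], by linarith [this.1]⟩
  refine ⟨hbdd, fun ε hε hTε => ?_⟩
  unfold NewtonProcess.output
  -- A returned saddle point has gap at most 0 and needs only boundedness; the rate is used in the
  -- last case alone.
  split_ifs with h1 h2
  · exact h1.isEpsGlobalSaddle hε.le (hbdd (T - 1) (by omega)).1
  · exact h2.isEpsGlobalSaddle hε.le (hbdd (T - 1) (by omega)).2
  · have := hpath.average_isEpsGlobalSaddle hρ hT hdiff hcc hs (not_or.2 ⟨h1, h2⟩) hε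
      (by simpa only [hz0] using hTε)
    simp only [hz0] at this
    exact this
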